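/- **Setting.** Let $V$ be a complex Hausdorff locally convex space whose topology is defined by the seminorms $\|v\|_\alpha=\sqrt{\langle v,v\rangle_\alpha}$, where $\langle\cdot,\cdot\rangle_\alpha$ runs over all continuous positive (semi-definite) Hermitian forms on $V$ (antilinear in the first argument). On $\mathcal T^\bullet(V)=\bigoplus_{k\ge 0}V^{\otimes k}$ (algebraic tensor powers) put the locally convex topology defined by the seminorms of the sesquilinear extensions $$\langle X,Y\rangle_\alpha^\bullet=\sum_{k\ge0}\langle X_k,Y_k\rangle^\bullet_\alpha,\qquad \langle x_1\otimes\cdots\otimes x_k,\,y_1\otimes\cdots\otimes y_k\rangle^\bullet_\alpha=k!\prod_{m=1}^k\langle x_m,y_m\rangle_\alpha .$$ Let $\mathcal S^\bullet(V)\subseteq\mathcal T^\bullet(V)$ be the space of symmetric tensors, i.e. the image of the symmetrisation projector $\mathscr S$, with the subspace topology, and let $\mathcal S^\bullet(V)^{\mathrm{cpl}}$ be its completion. For a bilinear form $\Lambda$ on $V$ and $X,Y\in\mathcal S^\bullet(V)$ let $$X\star_\Lambda Y=\sum_{t=0}^\infty\frac1{t!}\,\mu_\vee\big((P_\Lambda)^t(X\otimes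 Y)\big),\qquad \mu_\vee(X\otimes Y)=\mathscr S(X\otimes Y),$$ where $P_\Lambda\big((x_1\otimes\cdots\otimes x_k)\otimes(y_1\otimes\cdots\otimes y_\ell)\big)=k\ell\,\Lambda(x_k,y_1)\,(x_1\otimes\cdots\otimes x_{k-1})\otimes(y_2\otimes\cdots\otimes y_\ell)$ for $k,\ell\ge1$, and $P_\Lambda=0$ if $k=0$ or $\ell=0$. For a bilinear form $b$ on $V$ let $\Delta_b$ be the linear operator on $\mathcal T^\bullet(V)$ with $\Delta_b(x_1\otimes\cdots\otimes x_k)=\frac{k(k-1)}2\,b(x_1,x_2)\,x_3\otimes\cdots\otimes x_k$ for $k\ge2$ and $\Delta_b=0$ in degrees $0,1$; it maps $\mathcal S^\bullet(V)$ into itself. Put $e^{\Delta_b}=\sum_{t\ge0}\frac1{t!}(\Delta_b)^t$ (a finite sum on every vector). The form $b$ is *of Hilbert–Schmidt type* if there is a continuous positive Hermitian form $\langle\cdot,\cdot\rangle_\alpha$ on $V$ such that $b(v,w)=0$ whenever $\|v\|_\alpha=0$ or $\|w\|_\alpha=0$, and $\sum_{i,j=1}^d|b(e_i,e_j)|^2\le1$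 for every finite $\langle\cdot,\cdot\rangle_\alpha$-orthonormal tuple $(e_1,\dots,e_d)$ in $V$. **Theorem.** Let $b$ be a symmetric (not necessarily continuous) bilinear form on $V$. 1. $e^{\Delta_b}\colon\mathcal T^\bullet(V)\to\mathcal T^\bullet(V)$ is continuous if and only if $b$ is of Hilbert–Schmidt type; likewise, the restriction of $e^{\Delta_b}$ to $\mathcal S^\bullet(V)$ is continuous if and only if $b$ is of Hilbert–Schmidt type. Assume from now on that $b$ is of Hilbert–Schmidt type. 2. For every continuous bilinear form $\Lambda$ on $V$, the form $\Lambda+b$ is continuous and $$e^{\Delta_b}(X\star_\Lambda Y)=\big(e^{\Delta_b}X\big)\star_{\Lambda+b}\big(e^{\Delta_b}Y\big)\qquad\text{for all }X,Y\in\mathcal S^\bullet(V).$$ 3. Hence, for every continuous bilinear form $\Lambda$ on $V$, the restriction of $e^{\Delta_b}$ is an isomorphism of the locally convex algebras $(\mathcal S^\bullet(V),\star_\Lambda)$ and $(\mathcal S^\bullet(V),\star_{\Lambda+b})$, i.e. a linear homeomorphism of $\mathcal S^\bullet(V)$ onto itself that carries $\star_\Lambda$ to $\star_{\Lambda+b}$.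 4. $\Delta_b$ extends to a continuous linear operator, again denoted by $\Delta_b$, on $\mathcal S^\bullet(V)^{\mathrm{cpl}}$. For every $X\in\mathcal S^\bullet(V)^{\mathrm{cpl}}$ the series $e^{z\Delta_b}X=\sum_{t=0}^\infty\frac{z^t}{t!}(\Delta_b)^tX$ converges absolutely (with respect to every continuous seminorm) for every $z\in\mathbb C$ and locally uniformly in $z\in\mathbb C$, and its sum is a holomorphic function of $z\in\mathbb C$ with values in $\mathcal S^\bullet(V)^{\mathrm{cpl}}$. -/

import Mathlib

open scoped TensorProduct ComplexConjugate DirectSum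

noncomputable section

namespace HilbertTensor

/-! ### Positive Hermitian forms and their seminorms -/

/-- A sesquilinear form (antilinear in the first argument) which is Hermitian and positive
semi-definite. -/
structure IsPosHermitian {E : Type*} [AddCommGroup E] [Module ℂ E]
    (f : E →ₗ⋆[ℂ] E →ₗ[ℂ] ℂ) : Prop where
  conj_symm : ∀ v w, conj (f v w) = f w v
  nonneg : ∀ v, 0 ≤ (f v v).re

/-- The pre-inner product given by a positive Hermitian form. -/
abbrev IsPosHermitian.core {E : Type*} [AddCommGroup E] [Module ℂ E]
    {f : E →ₗ⋆[ℂ] E →ₗ[ℂ] ℂ} (hf : IsPosHermitian f) : PreInnerProductSpace.Core ℂ E where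
  inner v w := f v w
  conj_inner_symm v w := hf.conj_symm w v
  re_inner_nonneg v := hf.nonneg v
  add_left u v w := by simp
  smul_left u v r := by simp

/-- The Hilbert seminorm `v ↦ √⟨v, v⟩` of a positive Hermitian form. -/
def IsPosHermitian.seminorm {E : Type*} [AddCommGroup E] [Module ℂ E]
    {f : E →ₗ⋆[ℂ] E →ₗ[ℂ] ℂ} (hf : IsPosHermitian f) : Seminorm ℂ E :=
  Seminorm.of (fun v => √(f v v).re)
    (by
      let := hf.core
      let : SeminormedAddCommGroup E := InnerProductSpace.Core.toSeminormedAddCommGroup (𝕜 := ℂ)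
      intro v w
      exact norm_add_le v w)
    (by
      let := hf.core
      let : SeminormedAddCommGroup E := InnerProductSpace.Core.toSeminormedAddCommGroup (𝕜 := ℂ)
      let : NormedSpace ℂ E := InnerProductSpace.Core.toNormedSpace
      intro a v
      exact norm_smul a v)

/-- The set of continuous positive Hermitian forms on `V`. -/
structure ContForm (V : Type*) [AddCommGroup V] [Module ℂ V] [TopologicalSpace V] where
  /-- the sesquilinear form, antilinear in the first argument -/
  form : V →ₗ⋆[ℂ] V →ₗ[ℂ] ℂ
  isPosHermitian : IsPosHermitian form
  continuous_form : Continuous fun p : V × V => form p.1 p.2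

instance (V : Type*) [AddCommGroup V] [Module ℂ V] [TopologicalSpace V] :
    Nonempty (ContForm V) :=
  ⟨⟨0, ⟨by simp, by simp⟩, by simpa using continuous_const⟩⟩

/-- The family of all continuous Hilbert seminorms on `V`. -/
def hilbertSeminorms (V : Type*) [AddCommGroup V] [Module ℂ V] [TopologicalSpace V] :
    SeminormFamily ℂ V (ContForm V) :=
  fun α => α.isPosHermitian.seminorm

/-! ### The tensor algebra and the extended forms -/

/-- The vector space `⨁ₖ V^{⊗k}` underlying the tensor algebra. -/
abbrev Tens (V : Type*) [AddCommGroup V] [Module ℂ V] : Type _ :=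
  ⨁ k : ℕ, ⨂[ℂ]^k V

section Algebraic

variable {V : Type*} [AddCommGroup V] [Module ℂ V]

/-- The linear functional `x₁ ⊗ ⋯ ⊗ xₖ ↦ ∏ₘ ⟨yₘ, xₘ⟩` on `V^{⊗k}`. -/
def prodFunctional (f : V →ₗ⋆[ℂ] V →ₗ[ℂ] ℂ) {k : ℕ} (y : Fin k → V) : (⨂[ℂ]^k V) →ₗ[ℂ] ℂ :=
  PiTensorProduct.lift
    ((MultilinearMap.mkPiAlgebra ℂ (Fin k) ℂ).compLinearMap fun m => f (y m))

theorem prodFunctional_tprod (f : V →ₗ⋆[ℂ] V →ₗ[ℂ] ℂ) {k : ℕ} (y x : Fin k → V) :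
    prodFunctional f y (PiTensorProduct.tprod ℂ x) = ∏ m, f (y m) (x m) := by
  simp [prodFunctional]

theorem apply_update (f : V →ₗ⋆[ℂ] V →ₗ[ℂ] ℂ) {k : ℕ} [DecidableEq (Fin k)]
    (y x : Fin k → V) (i : Fin k) (v : V) :
    ∏ m, f (Function.update y i v m) (x m) = f v (x i) * ∏ m ∈ {i}ᶜ, f (y m) (x m) := by
  rw [Fintype.prod_eq_mul_prod_compl i]
  simp only [Function.update_self]
  congr 1
  refine Finset.prod_congr rfl fun m hm => ?_
  have : m ≠ i := by simpa using hm
  simp [this]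

theorem prodFunctional_update_add (f : V →ₗ⋆[ℂ] V →ₗ[ℂ] ℂ) {k : ℕ} [DecidableEq (Fin k)]
    (y : Fin k → V) (i : Fin k) (v w : V) :
    prodFunctional f (Function.update y i (v + w)) =
      prodFunctional f (Function.update y i v) + prodFunctional f (Function.update y i w) := by
  ext x
  simp only [LinearMap.compMultilinearMap_apply, LinearMap.add_apply, prodFunctional_tprod,
    apply_update, map_add, add_mul]

theorem prodFunctional_update_smul (f : V →ₗ⋆[ℂ] V →ₗ[ℂ] ℂ) {k : ℕ} [DecidableEq (Fin k)]
    (y : Fin k → V) (i : Fin k) (c : ℂ) (v : V) :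
    prodFunctional f (Function.update y i (c • v)) =
      conj c • prodFunctional f (Function.update y i v) := by
  ext x
  simp only [LinearMap.compMultilinearMap_apply, LinearMap.smul_apply, prodFunctional_tprod,
    apply_update, map_smulₛₗ, smul_eq_mul, mul_assoc]

/-- The sesquilinear form on `V^{⊗k}` with
`⟨x₁ ⊗ ⋯ ⊗ xₖ, y₁ ⊗ ⋯ ⊗ yₖ⟩ = ∏ₘ ⟨xₘ, yₘ⟩` for a Hermitian form `⟨·, ·⟩` on `V`. It is the linear
extension in `y` of the map `(X, y) ↦ conj (∏ₘ ⟨yₘ, Xₘ⟩)`. -/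
def powForm (f : V →ₗ⋆[ℂ] V →ₗ[ℂ] ℂ) (k : ℕ) :
    (⨂[ℂ]^k V) →ₗ⋆[ℂ] (⨂[ℂ]^k V) →ₗ[ℂ] ℂ :=
  (PiTensorProduct.lift (R := ℂ) (E := (⨂[ℂ]^k V) →ₗ⋆[ℂ] ℂ)
    (MultilinearMap.mk' (fun y : Fin k → V =>
      ((starLinearEquiv ℂ (A := ℂ)).toLinearMap.comp (prodFunctional f y) :
        (⨂[ℂ]^k V) →ₗ⋆[ℂ] ℂ))
      (fun y i v w => by
        ext X
        simp [prodFunctional_update_add])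
      (fun y i c v => by
        ext X
        simp [prodFunctional_update_smul]))).flip

theorem powForm_tprod {f : V →ₗ⋆[ℂ] V →ₗ[ℂ] ℂ} (hf : IsPosHermitian f) {k : ℕ}
    (x y : Fin k → V) :
    powForm f k (PiTensorProduct.tprod ℂ x) (PiTensorProduct.tprod ℂ y) = ∏ m, f (x m) (y m) := by
  rw [powForm, LinearMap.flip_apply, PiTensorProduct.lift.tprod]
  simp [prodFunctional_tprod, hf.conj_symm]

/-- The form on the tensor algebra:
`⟨X, Y⟩ = ∑ₖ k! ⟨Xₖ, Yₖ⟩`, where `Xₖ` is the component of degree `k`. -/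
def extForm (f : V →ₗ⋆[ℂ] V →ₗ[ℂ] ℂ) : Tens V →ₗ⋆[ℂ] Tens V →ₗ[ℂ] ℂ where
  toFun X := DirectSum.toModule ℂ ℕ ℂ fun k => (k.factorial : ℂ) • powForm f k (X k)
  map_add' X Y := by
    ext k : 1
    ext y
    simp
  map_smul' c X := by
    ext k : 1
    ext y
    simp [DirectSum.smul_apply, mul_left_comm]

theorem extForm_apply (f : V →ₗ⋆[ℂ] V →ₗ[ℂ] ℂ) (X Y : Tens V) (s : Finset ℕ)
    (hs : ∀ k ∉ s, Y k = 0) :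
    extForm f X Y = ∑ k ∈ s, (k.factorial : ℂ) * powForm f k (X k) (Y k) := by
  classical
  have hY : Y = ∑ k ∈ s, DirectSum.lof ℂ ℕ (fun k => ⨂[ℂ]^k V) k (Y k) := by
    ext k : 1
    rw [DirectSum.sum_apply]
    by_cases hk : k ∈ s
    · rw [Finset.sum_eq_single_of_mem k hk, DirectSum.lof_apply]
      intro j _ hj
      exact DirectSum.of_eq_of_ne _ _ _ hj.symm
    · rw [hs k hk, Finset.sum_eq_zero]
      intro j hj
      have : k ≠ j := fun h => hk (h ▸ hj)
      exact DirectSum.of_eq_of_ne _ _ _ this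
  conv_lhs => rw [hY]
  simp [extForm]

open scoped ComplexOrder in
/-- The Gram matrix of a positive Hermitian form. -/
theorem gram_posSemidef {f : V →ₗ⋆[ℂ] V →ₗ[ℂ] ℂ} (hf : IsPosHermitian f) {ι : Type*} (e : ι → V) :
    (Matrix.of fun i j => f (e i) (e j)).PosSemidef := by
  refine ⟨?_, fun c => ?_⟩
  · ext i j
    simpa using hf.conj_symm (e j) (e i)
  · have h : (c.sum fun i ci => c.sum fun j cj => star ci * f (e i) (e j) * cj) =
        f (c.sum fun i ci => ci • e i) (c.sum fun i ci => ci • e i) := by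
      simp only [Finsupp.sum, map_sum, LinearMap.sum_apply, map_smulₛₗ, LinearMap.smul_apply,
        smul_eq_mul, Finset.mul_sum]
      rw [Finset.sum_comm]
      refine Finset.sum_congr rfl fun i _ => Finset.sum_congr rfl fun j _ => ?_
      simp [mul_comm, mul_left_comm]
    simp only [Matrix.of_apply]
    rw [h]
    set v := c.sum fun i ci => ci • e i
    have him := Complex.conj_eq_iff_im.1 (hf.conj_symm v v)
    exact Complex.nonneg_iff.2 ⟨hf.nonneg v, him.symm⟩

open scoped ComplexOrder in
theorem prod_gram_posSemidef {f : V →ₗ⋆[ℂ] V →ₗ[ℂ] ℂ} (hf : IsPosHermitian f) {k : ℕ}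
    (s : Finset (Fin k)) :
    (Matrix.of fun x y : Fin k → V => ∏ m ∈ s, f (x m) (y m)).PosSemidef := by
  classical
  induction s using Finset.induction_on with
  | empty =>
    refine ⟨by ext; simp, fun c => ?_⟩
    have h : (c.sum fun i ci => c.sum fun j cj => star ci * (1 : ℂ) * cj) =
        star (c.sum fun _ ci => ci) * c.sum fun _ ci => ci := by
      simp only [Finsupp.sum, star_sum, Finset.sum_mul_sum, mul_one]
    simp only [Finset.prod_empty, Matrix.of_apply]
    rw [h]
    exact star_mul_self_nonneg _
  | insert a s ha ih =>
    have h : (Matrix.of fun x y : Fin k → V => ∏ m ∈ insert a s, f (x m) (y m)) =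
        (Matrix.of fun x y : Fin k → V => f (x a) (y a)).hadamard
          (Matrix.of fun x y : Fin k → V => ∏ m ∈ s, f (x m) (y m)) := by
      ext x y
      simp [Finset.prod_insert ha]
    rw [h]
    exact (gram_posSemidef hf fun x : Fin k → V => x a).hadamard ih

theorem exists_eq_sum_tprod {k : ℕ} (X : ⨂[ℂ]^k V) :
    ∃ c : (Fin k → V) →₀ ℂ, X = c.sum fun x a => a • PiTensorProduct.tprod ℂ x := by
  have hX : X ∈ Submodule.span ℂ (Set.range (PiTensorProduct.tprod ℂ (s := fun _ : Fin k => V))) := by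
    rw [PiTensorProduct.span_tprod_eq_top]
    trivial
  obtain ⟨c, hc⟩ := (Finsupp.mem_span_range_iff_exists_finsupp).1 hX
  exact ⟨c, hc.symm⟩

open scoped ComplexOrder in
theorem powForm_isPosHermitian {f : V →ₗ⋆[ℂ] V →ₗ[ℂ] ℂ} (hf : IsPosHermitian f) (k : ℕ) :
    IsPosHermitian (powForm f k) where
  conj_symm X Y := by
    obtain ⟨c, rfl⟩ := exists_eq_sum_tprod X
    obtain ⟨d, rfl⟩ := exists_eq_sum_tprod Y
    simp only [Finsupp.sum, map_sum, LinearMap.sum_apply, map_smulₛₗ, LinearMap.smul_apply,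
      smul_eq_mul, powForm_tprod hf, map_mul, map_prod, hf.conj_symm, Finset.mul_sum]
    rw [Finset.sum_comm]
    refine Finset.sum_congr rfl fun i _ => Finset.sum_congr rfl fun j _ => ?_
    simp [mul_left_comm]
  nonneg X := by
    obtain ⟨c, rfl⟩ := exists_eq_sum_tprod X
    have h := (prod_gram_posSemidef hf (Finset.univ : Finset (Fin k))).2 c
    have h2 : (c.sum fun i ci => c.sum fun j cj => star ci *
          (Matrix.of fun x y : Fin k → V => ∏ m, f (x m) (y m)) i j * cj) =
        powForm f k (c.sum fun x a => a • PiTensorProduct.tprod ℂ x)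
          (c.sum fun x a => a • PiTensorProduct.tprod ℂ x) := by
      simp only [Finsupp.sum, map_sum, LinearMap.sum_apply, map_smulₛₗ, LinearMap.smul_apply,
        smul_eq_mul, powForm_tprod hf, Finset.mul_sum, Matrix.of_apply]
      rw [Finset.sum_comm]
      refine Finset.sum_congr rfl fun i _ => Finset.sum_congr rfl fun j _ => ?_
      simp [mul_comm, mul_left_comm]
    rw [← h2]
    exact (Complex.nonneg_iff.1 h).1

theorem extForm_isPosHermitian {f : V →ₗ⋆[ℂ] V →ₗ[ℂ] ℂ} (hf : IsPosHermitian f) :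
    IsPosHermitian (extForm f) where
  conj_symm X Y := by
    classical
    have hX : ∀ k ∉ DFinsupp.support X ∪ DFinsupp.support Y, X k = 0 := by
      intro k hk
      simp only [Finset.mem_union, not_or, DFinsupp.notMem_support_iff] at hk
      exact hk.1
    have hY : ∀ k ∉ DFinsupp.support X ∪ DFinsupp.support Y, Y k = 0 := by
      intro k hk
      simp only [Finset.mem_union, not_or, DFinsupp.notMem_support_iff] at hk
      exact hk.2
    rw [extForm_apply f X Y _ hY, extForm_apply f Y X _ hX, map_sum]
    refine Finset.sum_congr rfl fun k _ => ?_
    rw [map_mul, (powForm_isPosHermitian hf k).conj_symm]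
    simp
  nonneg X := by
    classical
    rw [extForm_apply f X X (DFinsupp.support X) fun k hk => DFinsupp.notMem_support_iff.1 hk,
      Complex.re_sum]
    refine Finset.sum_nonneg fun k _ => ?_
    rw [← Complex.ofReal_natCast, Complex.re_ofReal_mul]
    exact mul_nonneg (Nat.cast_nonneg _) ((powForm_isPosHermitian hf k).nonneg _)

end Algebraic

/-- The seminorms `X ↦ √⟨X, X⟩` on the tensor algebra extending the continuous Hilbert seminorms
on `V`. -/
def tensSeminorms (V : Type*) [AddCommGroup V] [Module ℂ V] [TopologicalSpace V] :
    SeminormFamily ℂ (Tens V) (ContForm V) :=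
  fun α => (extForm_isPosHermitian α.isPosHermitian).seminorm

section Topology

variable {V : Type*} [AddCommGroup V] [Module ℂ V] [TopologicalSpace V]

/-- The locally convex topology (with its uniform structure) on the tensor algebra, defined by the
extensions of all continuous Hilbert seminorms on `V`. -/
instance : UniformSpace (Tens V) :=
  (tensSeminorms V).addGroupFilterBasis.uniformSpace

theorem withSeminorms_tens : WithSeminorms (tensSeminorms V) := ⟨rfl⟩

instance : IsUniformAddGroup (Tens V) :=
  (tensSeminorms V).addGroupFilterBasis.isUniformAddGroup

instance : ContinuousSMul ℂ (Tens V) := withSeminorms_tens.continuousSMul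

end Topology

/-! ### Exponential series of locally nilpotent operators -/

section Exponential

variable {E : Type*} [AddCommMonoid E] [Module ℂ E]

/-- Every vector is annihilated by some power of `D`. -/
def LocallyNilpotent (D : E →ₗ[ℂ] E) : Prop := ∀ X, ∃ N, (D ^ N) X = 0

theorem pow_apply_eq_zero_of_le {D : E →ₗ[ℂ] E} {X : E} {N M : ℕ} (h : (D ^ N) X = 0)
    (hNM : N ≤ M) : (D ^ M) X = 0 := by
  obtain ⟨j, rfl⟩ := Nat.exists_eq_add_of_le' hNM
  rw [pow_add, Module.End.mul_apply, h, map_zero]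

theorem exists_pow_add {D : E →ₗ[ℂ] E} {X Y : E} (hX : ∃ N, (D ^ N) X = 0)
    (hY : ∃ N, (D ^ N) Y = 0) : ∃ N, (D ^ N) (X + Y) = 0 := by
  obtain ⟨N, hN⟩ := hX
  obtain ⟨M, hM⟩ := hY
  refine ⟨max N M, ?_⟩
  rw [map_add, pow_apply_eq_zero_of_le hN (le_max_left _ _),
    pow_apply_eq_zero_of_le hM (le_max_right _ _), add_zero]

theorem exists_pow_of_apply {D : E →ₗ[ℂ] E} {X : E} (h : ∃ N, (D ^ N) (D X) = 0) :
    ∃ N, (D ^ N) X = 0 := by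
  obtain ⟨N, hN⟩ := h
  exact ⟨N + 1, by rw [pow_succ, Module.End.mul_apply, hN]⟩

theorem LocallyNilpotent.finite_support {D : E →ₗ[ℂ] E} (hD : LocallyNilpotent D) (X : E) :
    (Function.support fun t : ℕ => ((t.factorial : ℂ)⁻¹) • (D ^ t) X).Finite := by
  obtain ⟨N, hN⟩ := hD X
  refine (Set.finite_lt_nat N).subset fun t ht => ?_
  by_contra h
  exact ht (by simp [pow_apply_eq_zero_of_le hN (not_lt.1 h)])

/-- The exponential `e^D = ∑ₜ (1/t!) D^t` of a locally nilpotent operator; for every vector the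
sum has only finitely many nonzero terms. -/
def LocallyNilpotent.exp {D : E →ₗ[ℂ] E} (hD : LocallyNilpotent D) : E →ₗ[ℂ] E where
  toFun X := ∑ᶠ t : ℕ, ((t.factorial : ℂ)⁻¹) • (D ^ t) X
  map_add' X Y := by
    rw [← finsum_add_distrib (hD.finite_support X) (hD.finite_support Y)]
    simp only [map_add, smul_add]
  map_smul' c X := by
    rw [RingHom.id_apply, smul_finsum' c (hD.finite_support X)]
    simp only [map_smul, smul_comm c]

theorem LocallyNilpotent.exp_mem {D : E →ₗ[ℂ] E} (hD : LocallyNilpotent D) (S : Submodule ℂ E)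
    (hS : ∀ X ∈ S, D X ∈ S) {X : E} (hX : X ∈ S) : hD.exp X ∈ S := by
  refine finsum_induction (· ∈ S) S.zero_mem (fun _ _ => S.add_mem) fun t => S.smul_mem _ ?_
  induction t with
  | zero => simpa using hX
  | succ t ih =>
    rw [pow_succ', Module.End.mul_apply]
    exact hS _ ih

end Exponential

/-! ### Symmetric tensors, star products and Laplace operators -/

section Operators

variable {V : Type*} [AddCommGroup V] [Module ℂ V]

/-- The inclusion of the tensors of degree `k` into the tensor algebra. -/
abbrev incl (k : ℕ) : (⨂[ℂ]^k V) →ₗ[ℂ] Tens V := DirectSum.lof ℂ ℕ (fun k => ⨂[ℂ]^k V) k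

/-- The permutation action `(x₁ ⊗ ⋯ ⊗ xₖ)^σ = x_{σ(1)} ⊗ ⋯ ⊗ x_{σ(k)}`. -/
def permute {k : ℕ} (σ : Equiv.Perm (Fin k)) : (⨂[ℂ]^k V) →ₗ[ℂ] (⨂[ℂ]^k V) :=
  (PiTensorProduct.reindex ℂ (fun _ => V) σ.symm).toLinearMap

theorem permute_tprod {k : ℕ} (σ : Equiv.Perm (Fin k)) (x : Fin k → V) :
    permute σ (PiTensorProduct.tprod ℂ x) = PiTensorProduct.tprod ℂ fun i => x (σ i) := by
  rw [permute, LinearEquiv.coe_coe, PiTensorProduct.reindex_tprod]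
  rfl

/-- Symmetrisation in degree `k`: `X ↦ (1/k!) ∑_σ X^σ`. -/
def symPow (k : ℕ) : (⨂[ℂ]^k V) →ₗ[ℂ] (⨂[ℂ]^k V) :=
  ((k.factorial : ℂ)⁻¹) • ∑ σ : Equiv.Perm (Fin k), permute σ

variable (V) in
/-- The symmetrisation operator on the tensor algebra. -/
def symmetrizer : Tens V →ₗ[ℂ] Tens V :=
  DirectSum.toModule ℂ ℕ (Tens V) fun k => incl k ∘ₗ symPow k

variable (V) in
/-- The space of symmetric tensors, the image of the symmetrisation operator. -/
def SymTens : Submodule ℂ (Tens V) := LinearMap.range (symmetrizer V)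

/-- The map `x₁ ⊗ ⋯ ⊗ x_{k+1} ↦ (x₂ ⊗ ⋯ ⊗ x_{k+1}) ⊗ x₁`. -/
def splitFirst (k : ℕ) : (⨂[ℂ]^(k + 1) V) →ₗ[ℂ] (⨂[ℂ]^k V) ⊗[ℂ] V :=
  PiTensorProduct.lift (LinearMap.uncurryLeft (M := fun _ : Fin (k + 1) => V)
    ((PiTensorProduct.lift (R := ℂ) (s := fun _ : Fin k => V)).symm.toLinearMap ∘ₗ
      (TensorProduct.mk ℂ (⨂[ℂ]^k V) V).flip))

/-- The map `x₁ ⊗ ⋯ ⊗ x_{k+1} ↦ (x₁ ⊗ ⋯ ⊗ xₖ) ⊗ x_{k+1}`. -/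
def splitLast (k : ℕ) : (⨂[ℂ]^(k + 1) V) →ₗ[ℂ] (⨂[ℂ]^k V) ⊗[ℂ] V :=
  PiTensorProduct.lift (MultilinearMap.uncurryRight (M := fun _ : Fin (k + 1) => V)
    ((TensorProduct.mk ℂ (⨂[ℂ]^k V) V).compMultilinearMap (PiTensorProduct.tprod ℂ)))

theorem splitFirst_tprod (k : ℕ) (x : Fin (k + 1) → V) :
    splitFirst k (PiTensorProduct.tprod ℂ x) =
      (PiTensorProduct.tprod ℂ fun i : Fin k => x i.succ) ⊗ₜ[ℂ] x 0 := by
  simp [splitFirst]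
  rfl

theorem splitLast_tprod (k : ℕ) (x : Fin (k + 1) → V) :
    splitLast k (PiTensorProduct.tprod ℂ x) =
      (PiTensorProduct.tprod ℂ fun i : Fin k => x i.castSucc) ⊗ₜ[ℂ] x (Fin.last k) := by
  simp [splitLast]
  rfl

/-- The contraction `(A ⊗ v) ⊗ (B ⊗ w) ↦ Λ(v, w) A ⊗ B`. -/
def pairing (Λ : LinearMap.BilinForm ℂ V) (k l : ℕ) :
    ((⨂[ℂ]^k V) ⊗[ℂ] V) ⊗[ℂ] ((⨂[ℂ]^l V) ⊗[ℂ] V) →ₗ[ℂ] (⨂[ℂ]^k V) ⊗[ℂ] (⨂[ℂ]^l V) :=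
  (TensorProduct.rid ℂ _).toLinearMap ∘ₗ
    TensorProduct.map LinearMap.id (TensorProduct.lift Λ) ∘ₗ
      (TensorProduct.tensorTensorTensorComm ℂ (⨂[ℂ]^k V) V (⨂[ℂ]^l V) V).toLinearMap

/-- The operator `P_Λ` in degrees `k` and `l`, with values in the tensor square of the tensor
algebra:
`(x₁ ⊗ ⋯ ⊗ xₖ) ⊗ (y₁ ⊗ ⋯ ⊗ y_l) ↦ k l Λ(xₖ, y₁) (x₁ ⊗ ⋯ ⊗ xₖ₋₁) ⊗ (y₂ ⊗ ⋯ ⊗ y_l)`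
for `k, l ≥ 1`, and zero if `k = 0` or `l = 0`. -/
def poissonDeg (Λ : LinearMap.BilinForm ℂ V) :
    (k l : ℕ) → (⨂[ℂ]^k V) ⊗[ℂ] (⨂[ℂ]^l V) →ₗ[ℂ] Tens V ⊗[ℂ] Tens V
  | k + 1, l + 1 => (((k + 1) * (l + 1) : ℕ) : ℂ) •
      (TensorProduct.map (incl k) (incl l) ∘ₗ pairing Λ k l ∘ₗ
        TensorProduct.map (splitLast k) (splitFirst l))
  | _, _ => 0

/-- The operator `P_Λ` on the tensor square of the tensor algebra. -/
def poisson (Λ : LinearMap.BilinForm ℂ V) : Tens V ⊗[ℂ] Tens V →ₗ[ℂ] Tens V ⊗[ℂ] Tens V :=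
  TensorProduct.lift
    (DirectSum.toModule ℂ ℕ (Tens V →ₗ[ℂ] Tens V ⊗[ℂ] Tens V) fun k =>
      (DirectSum.toModule ℂ ℕ ((⨂[ℂ]^k V) →ₗ[ℂ] Tens V ⊗[ℂ] Tens V) fun l =>
        (TensorProduct.curry (poissonDeg Λ k l)).flip).flip)

theorem poisson_map (Λ : LinearMap.BilinForm ℂ V) (k l : ℕ) (Z : (⨂[ℂ]^k V) ⊗[ℂ] (⨂[ℂ]^l V)) :
    poisson Λ (TensorProduct.map (incl k) (incl l) Z) = poissonDeg Λ k l Z := by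
  have h : poisson Λ ∘ₗ TensorProduct.map (incl k) (incl l) = poissonDeg Λ k l := by
    refine TensorProduct.ext' fun x y => ?_
    simp [poisson]
  exact LinearMap.congr_fun h Z

theorem poisson_locallyNilpotent (Λ : LinearMap.BilinForm ℂ V) :
    LocallyNilpotent (poisson Λ) := by
  have key : ∀ (k l : ℕ) (Z : (⨂[ℂ]^k V) ⊗[ℂ] (⨂[ℂ]^l V)),
      ∃ N, (poisson Λ ^ N) (TensorProduct.map (incl k) (incl l) Z) = 0 := by
    intro k
    induction k with
    | zero =>
      intro l Z
      exact ⟨1, by rw [pow_one, poisson_map]; simp [poissonDeg]⟩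
    | succ k ih =>
      intro l Z
      cases l with
      | zero => exact ⟨1, by rw [pow_one, poisson_map]; simp [poissonDeg]⟩
      | succ l =>
        refine exists_pow_of_apply ?_
        rw [poisson_map]
        simp only [poissonDeg, LinearMap.smul_apply, LinearMap.comp_apply]
        obtain ⟨N, hN⟩ := ih l (pairing Λ k l (TensorProduct.map (splitLast k) (splitFirst l) Z))
        exact ⟨N, by rw [map_smul, hN, smul_zero]⟩
  intro Z
  induction Z using TensorProduct.induction_on with
  | zero => exact ⟨0, by simp⟩
  | add X Y hX hY => exact exists_pow_add hX hY
  | tmul X Y =>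
    induction X using DirectSum.induction_on with
    | zero => exact ⟨0, by simp⟩
    | add X X' hX hX' =>
      rw [TensorProduct.add_tmul]
      exact exists_pow_add hX hX'
    | of k x =>
      induction Y using DirectSum.induction_on with
      | zero => exact ⟨0, by simp⟩
      | add Y Y' hY hY' =>
        rw [TensorProduct.tmul_add]
        exact exists_pow_add hY hY'
      | of l y => exact key k l (x ⊗ₜ y)

/-- The undeformed product `X ⊗ Y ↦ X ∨ Y`, the symmetrisation of the product of the tensor
algebra, with values in the symmetric tensors. -/
def mulVee : Tens V ⊗[ℂ] Tens V →ₗ[ℂ] SymTens V :=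
  (symmetrizer V).rangeRestrict ∘ₗ LinearMap.mul' ℂ (Tens V)

/-- The star product on symmetric tensors,
`X ⋆_Λ Y = ∑ₜ (1/t!) μ_∨ ((P_Λ)^t (X ⊗ Y))`. -/
def starProd (Λ : LinearMap.BilinForm ℂ V) : SymTens V →ₗ[ℂ] SymTens V →ₗ[ℂ] SymTens V :=
  TensorProduct.curry (mulVee ∘ₗ (poisson_locallyNilpotent Λ).exp ∘ₗ
    TensorProduct.map (SymTens V).subtype (SymTens V).subtype)

/-- The contraction of the first two factors,
`x₁ ⊗ ⋯ ⊗ x_{k+2} ↦ b(x₁, x₂) x₃ ⊗ ⋯ ⊗ x_{k+2}`. -/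
def contractFirst (b : LinearMap.BilinForm ℂ V) (k : ℕ) : (⨂[ℂ]^(k + 2) V) →ₗ[ℂ] (⨂[ℂ]^k V) :=
  (TensorProduct.rid ℂ _).toLinearMap ∘ₗ
    TensorProduct.map LinearMap.id (TensorProduct.lift b.flip) ∘ₗ
      (TensorProduct.assoc ℂ (⨂[ℂ]^k V) V V).toLinearMap ∘ₗ
        TensorProduct.map (splitFirst k) LinearMap.id ∘ₗ splitFirst (k + 1)

theorem contractFirst_tprod (b : LinearMap.BilinForm ℂ V) (k : ℕ) (x : Fin (k + 2) → V) :
    contractFirst b k (PiTensorProduct.tprod ℂ x) =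
      b (x 0) (x 1) • PiTensorProduct.tprod ℂ fun i : Fin k => x i.succ.succ := by
  simp [contractFirst, splitFirst_tprod]

/-- The Laplace operator in degree `k`:
`x₁ ⊗ ⋯ ⊗ xₖ ↦ (k(k-1)/2) b(x₁, x₂) x₃ ⊗ ⋯ ⊗ xₖ` for `k ≥ 2`, and zero for `k = 0, 1`. -/
def laplaceDeg (b : LinearMap.BilinForm ℂ V) : (k : ℕ) → (⨂[ℂ]^k V) →ₗ[ℂ] Tens V
  | 0 => 0
  | 1 => 0
  | k + 2 => (((k + 2 : ℂ) * (k + 1)) / 2) • (incl k ∘ₗ contractFirst b k)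

/-- The Laplace operator `Δ_b` on the tensor algebra. -/
def laplace (b : LinearMap.BilinForm ℂ V) : Tens V →ₗ[ℂ] Tens V :=
  DirectSum.toModule ℂ ℕ (Tens V) (laplaceDeg b)

theorem laplace_locallyNilpotent (b : LinearMap.BilinForm ℂ V) :
    LocallyNilpotent (laplace b) := by
  have key : ∀ (k : ℕ) (x : ⨂[ℂ]^k V), ∃ N, (laplace b ^ N) (incl k x) = 0 := by
    intro k
    induction k using Nat.strong_induction_on with
    | _ k ih =>
      intro x
      match k with
      | 0 => exact ⟨1, by simp [laplace, laplaceDeg]⟩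
      | 1 => exact ⟨1, by simp [laplace, laplaceDeg]⟩
      | k + 2 =>
        refine exists_pow_of_apply ?_
        obtain ⟨N, hN⟩ := ih k (by omega) (contractFirst b k x)
        refine ⟨N, ?_⟩
        simp only [laplace, DirectSum.toModule_lof, laplaceDeg, LinearMap.smul_apply,
          LinearMap.comp_apply, map_smul]
        rw [← laplace, hN, smul_zero]
  intro X
  induction X using DirectSum.induction_on with
  | zero => exact ⟨0, by simp⟩
  | add X Y hX hY => exact exists_pow_add hX hY
  | of k x => exact key k x

/-- The operator `e^{Δ_b}` on the tensor algebra. -/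
def expLaplace (b : LinearMap.BilinForm ℂ V) : Tens V →ₗ[ℂ] Tens V :=
  (laplace_locallyNilpotent b).exp

theorem permute_symPow {k : ℕ} (τ : Equiv.Perm (Fin k)) (x : ⨂[ℂ]^k V) :
    permute τ (symPow k x) = symPow k x := by
  have h : permute τ ∘ₗ symPow k = symPow (V := V) k := by
    ext x
    simp only [LinearMap.compMultilinearMap_apply, LinearMap.comp_apply, symPow,
      LinearMap.smul_apply, LinearMap.sum_apply, map_smul, map_sum, permute_tprod]
    congr 1
    exact Fintype.sum_equiv (Equiv.mulRight τ) _ _ fun σ => rfl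
  exact LinearMap.congr_fun h x

theorem liftPerm_apply {k : ℕ} (τ : Equiv.Perm (Fin k)) :
    (Equiv.Perm.decomposeFin.symm (0, Equiv.Perm.decomposeFin.symm (0, τ)) : Equiv.Perm _) 0 = 0 ∧
    (Equiv.Perm.decomposeFin.symm (0, Equiv.Perm.decomposeFin.symm (0, τ)) : Equiv.Perm _) 1 = 1 ∧
    ∀ i : Fin k, (Equiv.Perm.decomposeFin.symm
      (0, Equiv.Perm.decomposeFin.symm (0, τ)) : Equiv.Perm _) i.succ.succ = (τ i).succ.succ := by
  refine ⟨?_, ?_, fun i => ?_⟩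
  · rw [Equiv.Perm.decomposeFin_symm_apply_zero]
  · rw [Equiv.Perm.decomposeFin_symm_apply_one, Equiv.Perm.decomposeFin_symm_apply_zero]
    simp
  · rw [Equiv.Perm.decomposeFin_symm_apply_succ, Equiv.Perm.decomposeFin_symm_apply_succ]
    simp

theorem contractFirst_permute (b : LinearMap.BilinForm ℂ V) {k : ℕ} (τ : Equiv.Perm (Fin k))
    (x : ⨂[ℂ]^(k + 2) V) :
    contractFirst b k (permute (Equiv.Perm.decomposeFin.symm
      (0, Equiv.Perm.decomposeFin.symm (0, τ))) x) = permute τ (contractFirst b k x) := by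
  have h : contractFirst b k ∘ₗ permute (Equiv.Perm.decomposeFin.symm
      (0, Equiv.Perm.decomposeFin.symm (0, τ))) = permute τ ∘ₗ contractFirst b k := by
    ext x
    obtain ⟨h0, h1, h2⟩ := liftPerm_apply τ
    simp only [LinearMap.compMultilinearMap_apply, LinearMap.comp_apply, permute_tprod,
      contractFirst_tprod, map_smul]
    rw [h0, h1]
    exact congrArg (fun y => b (x 0) (x 1) • PiTensorProduct.tprod ℂ y)
      (funext fun i => congrArg x (h2 i))
  exact LinearMap.congr_fun h x

theorem symPow_eq_self {k : ℕ} {x : ⨂[ℂ]^k V} (h : ∀ τ, permute τ x = x) : symPow k x = x := by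
  have hk : (k.factorial : ℂ) ≠ 0 := by exact_mod_cast k.factorial_ne_zero
  simp only [symPow, LinearMap.smul_apply, LinearMap.sum_apply, h, Finset.sum_const,
    Finset.card_univ, Fintype.card_perm, Fintype.card_fin]
  rw [← Nat.cast_smul_eq_nsmul ℂ, smul_smul, inv_mul_cancel₀ hk, one_smul]

theorem laplace_mem_sym (b : LinearMap.BilinForm ℂ V) {X : Tens V} (hX : X ∈ SymTens V) :
    laplace b X ∈ SymTens V := by
  obtain ⟨X, rfl⟩ := hX
  induction X using DirectSum.induction_on with
  | zero => simp
  | add X Y hX hY => simpa only [map_add] using (SymTens V).add_mem hX hY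
  | of k x =>
    rw [← DirectSum.lof_eq_of ℂ, symmetrizer, DirectSum.toModule_lof, LinearMap.comp_apply,
      laplace, DirectSum.toModule_lof]
    match k with
    | 0 => exact (SymTens V).zero_mem
    | 1 => exact (SymTens V).zero_mem
    | k + 2 =>
      refine (SymTens V).smul_mem _ ⟨incl k (contractFirst b k (symPow (k + 2) x)), ?_⟩
      rw [symmetrizer, DirectSum.toModule_lof, LinearMap.comp_apply, LinearMap.comp_apply,
        symPow_eq_self]
      intro τ
      rw [← contractFirst_permute, permute_symPow]

/-- The restriction of `Δ_b` to the symmetric tensors. -/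
def laplaceSym (b : LinearMap.BilinForm ℂ V) : SymTens V →ₗ[ℂ] SymTens V :=
  (laplace b).restrict fun _ hX => laplace_mem_sym b hX

/-- The restriction of `e^{Δ_b}` to the symmetric tensors. -/
def expLaplaceSym (b : LinearMap.BilinForm ℂ V) : SymTens V →ₗ[ℂ] SymTens V :=
  (expLaplace b).restrict fun _ hX =>
    (laplace_locallyNilpotent b).exp_mem (SymTens V) (fun _ => laplace_mem_sym b) hX

end Operators

section Topology

variable {V : Type*} [AddCommGroup V] [Module ℂ V] [TopologicalSpace V]

instance : IsUniformAddGroup (SymTens V) :=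
  (SymTens V).toAddSubgroup.isUniformAddGroup

instance : UniformContinuousConstSMul ℂ (SymTens V) :=
  uniformContinuousConstSMul_of_continuousConstSMul ℂ (SymTens V)

variable (V) in
/-- The completion of the space of symmetric tensors. -/
abbrev SymCpl : Type _ := UniformSpace.Completion (SymTens V)

end Topology

/-- A bilinear form `b` on `V` is of Hilbert–Schmidt type if there is a continuous positive
Hermitian form `α` such that `b(v, w) = 0` whenever `‖v‖_α = 0` or `‖w‖_α = 0`, and
`∑_{i,j} |b(eᵢ, eⱼ)|² ≤ 1` for every finite `α`-orthonormal tuple `e`. -/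
def IsHilbertSchmidt {V : Type*} [AddCommGroup V] [Module ℂ V] [TopologicalSpace V]
    (b : LinearMap.BilinForm ℂ V) : Prop :=
  ∃ α : ContForm V,
    (∀ v w, hilbertSeminorms V α v = 0 ∨ hilbertSeminorms V α w = 0 → b v w = 0) ∧
    ∀ (d : ℕ) (e : Fin d → V), (∀ i j, α.form (e i) (e j) = if i = j then 1 else 0) →
      ∑ i, ∑ j, ‖b (e i) (e j)‖ ^ 2 ≤ 1

end HilbertTensor

end

noncomputable section

namespace HilbertTensor

/-! ### Positive semi-definite forms and orthonormal tuples -/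

section Forms

variable {E : Type*} [AddCommGroup E] [Module ℂ E]

/-! Hilbert–Schmidt type means that `b` is a functional of norm at most one on V ⊗ V for the Hilbert
seminorm of some continuous form. `Dominated` expresses this as positivity of a kernel on V × V, and
`dominated_of_orthonormal` derives it from Cauchy–Schwarz in an orthonormal tuple. In kernel
language the Schur product theorem does the tensor analysis: contracting two slots with `b` does not
increase the norm from V^{⊗(k+2)} to V^{⊗k}.

Continuity. Iterating, Δ_b^t from degree k+2t to degree k costs the factor (k+2t)!/(k! 2^t). Against
the weights k! of the norms this amounts to t! times an exponential in k and t, and exponentials are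
absorbed by rescaling: multiplying the form by r multiplies the squared norm in degree k by r^k. The
outcome, `IsHilbertSchmidt.exists_laplace_pow_le`, bounds the β-seminorm of Δ_b^t X by t! r^t times
the γ-seminorm of X, with r > 0 arbitrary and γ depending on r. This gives continuity of Δ_b and of
its exponential; on the completion, Δ_b^t X / t! decays faster than every geometric sequence, so the
exponential series is entire.

Converse. The scalar part of e^{Δ_b} on a tensor of degree two is its contraction with `b`.
Continuity on symmetric tensors bounds this functional by a Hilbert seminorm, and testing it on ∑
conj b(eᵢ, eⱼ) eᵢ ⊗ eⱼ gives the Hilbert–Schmidt bound.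

Algebra. On symmetric tensors Δ_b ∘ μ_∨ = μ_∨ ∘ (Δ_b ⊗ 1 + 1 ⊗ Δ_b + P_b), a second-order Leibniz
rule (`laplace_veePow`), and Δ_b ⊗ 1, 1 ⊗ Δ_b, P_b, P_Λ commute there. Exponentiating, e^{Δ_b} μ_∨
e^{P_Λ} = μ_∨ e^{P_{Λ+b}} (e^{Δ_b} ⊗ e^{Δ_b}). These facts are checked on divided powers v^{⊗n}/n!,
which span the symmetric tensors by polarization and whose exponents the operators merely lower. The
inverse of e^{Δ_b} is e^{Δ_{-b}}, continuous because -b is again of Hilbert–Schmidt type. -/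

theorem IsPosHermitian.seminorm_apply {f : E →ₗ⋆[ℂ] E →ₗ[ℂ] ℂ} (hf : IsPosHermitian f) (v : E) :
    hf.seminorm v = √(f v v).re := rfl

theorem IsPosHermitian.seminorm_sq {f : E →ₗ⋆[ℂ] E →ₗ[ℂ] ℂ} (hf : IsPosHermitian f) (v : E) :
    hf.seminorm v ^ 2 = (f v v).re :=
  Real.sq_sqrt (hf.nonneg v)

theorem IsPosHermitian.apply_self {f : E →ₗ⋆[ℂ] E →ₗ[ℂ] ℂ} (hf : IsPosHermitian f) (v : E) :
    f v v = ((hf.seminorm v ^ 2 : ℝ) : ℂ) := by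
  rw [hf.seminorm_sq]
  exact (Complex.conj_eq_iff_re.1 (hf.conj_symm v v)).symm

theorem IsPosHermitian.norm_apply_le {f : E →ₗ⋆[ℂ] E →ₗ[ℂ] ℂ} (hf : IsPosHermitian f) (v w : E) :
    ‖f v w‖ ≤ hf.seminorm v * hf.seminorm w := by
  let := hf.core
  let : SeminormedAddCommGroup E := InnerProductSpace.Core.toSeminormedAddCommGroup (𝕜 := ℂ)
  exact InnerProductSpace.Core.norm_inner_le_norm v w

theorem IsPosHermitian.add {f g : E →ₗ⋆[ℂ] E →ₗ[ℂ] ℂ} (hf : IsPosHermitian f)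
    (hg : IsPosHermitian g) : IsPosHermitian (f + g) where
  conj_symm v w := by simp [hf.conj_symm, hg.conj_symm]
  nonneg v := by simpa using add_nonneg (hf.nonneg v) (hg.nonneg v)

theorem IsPosHermitian.smul {f : E →ₗ⋆[ℂ] E →ₗ[ℂ] ℂ} (hf : IsPosHermitian f) {r : ℝ}
    (hr : 0 ≤ r) : IsPosHermitian ((r : ℂ) • f) where
  conj_symm v w := by simp [hf.conj_symm]
  nonneg v := by simpa using mul_nonneg hr (hf.nonneg v)

/-- Finitely many vectors are, up to null vectors, spanned by a finite orthonormal tuple. -/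
theorem IsPosHermitian.exists_orthonormal {f : E →ₗ⋆[ℂ] E →ₗ[ℂ] ℂ} (hf : IsPosHermitian f)
    (S : Finset E) : ∃ (d : ℕ) (e : Fin d → E), (∀ i j, f (e i) (e j) = if i = j then 1 else 0) ∧
      ∀ v ∈ S, hf.seminorm (v - ∑ i, f (e i) v • e i) = 0 := by
  let := hf.core
  let : SeminormedAddCommGroup E := InnerProductSpace.Core.toSeminormedAddCommGroup (𝕜 := ℂ)
  let : InnerProductSpace ℂ E := InnerProductSpace.ofCore hf.core
  -- As the form is only semi-definite, the orthonormal basis is chosen in the separation quotient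
  -- and lifted; lifting loses only null vectors.
  let W : Submodule ℂ (SeparationQuotient E) :=
    Submodule.span ℂ (SeparationQuotient.mk '' (S : Set E))
  have : FiniteDimensional ℂ W :=
    FiniteDimensional.span_of_finite ℂ (S.finite_toSet.image _)
  let u := stdOrthonormalBasis ℂ W
  choose e he using fun i => SeparationQuotient.surjective_mk (u i : SeparationQuotient E)
  have hin : ∀ x y : E, inner ℂ (SeparationQuotient.mk x) (SeparationQuotient.mk y) = f x y :=
    fun x y => rfl
  refine ⟨_, e, fun i j => ?_, fun v hv => ?_⟩
  · rw [← hin, he, he, ← Submodule.coe_inner]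
    exact orthonormal_iff_ite.1 u.orthonormal i j
  · let w : W := ⟨SeparationQuotient.mk v, Submodule.subset_span ⟨v, hv, rfl⟩⟩
    have h := u.sum_repr' w
    have h2 : SeparationQuotient.mk (v - ∑ i, f (e i) v • e i) = 0 := by
      have h3 := congrArg (Subtype.val) h
      rw [← SeparationQuotient.mkCLM_apply ℂ E, map_sub, map_sum]
      simp only [map_smul, SeparationQuotient.mkCLM_apply, he]
      rw [sub_eq_zero]
      refine Eq.trans h3.symm ?_
      rw [Submodule.coe_sum]
      refine Finset.sum_congr rfl fun i _ => ?_
      rw [← hin, he]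
      rfl
    have h4 : ‖v - ∑ i, f (e i) v • e i‖ = 0 := by
      rw [← SeparationQuotient.norm_mk, h2, norm_zero]
    exact h4

end Forms

/-! ### Positive kernels and the norm of a contraction -/

section Kernels

variable {V : Type*} [AddCommGroup V] [Module ℂ V]

open scoped ComplexOrder

/-- Writes the squared norm of a tensor as the quadratic form of a product kernel, so that norm
inequalities become positivity of kernels. -/
theorem powForm_apply_sum {f : V →ₗ⋆[ℂ] V →ₗ[ℂ] ℂ} (hf : IsPosHermitian f) {ι : Type*} (k : ℕ)
    (c : ι →₀ ℂ) (x : ι → Fin k → V) :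
    powForm f k (c.sum fun i a => a • PiTensorProduct.tprod ℂ (x i))
        (c.sum fun i a => a • PiTensorProduct.tprod ℂ (x i)) =
      c.sum fun i ci => c.sum fun j cj => star ci * (∏ m, f (x i m) (x j m)) * cj := by
  simp only [Finsupp.sum, map_sum, LinearMap.sum_apply, map_smulₛₗ, LinearMap.smul_apply,
    smul_eq_mul, powForm_tprod hf, Finset.mul_sum]
  rw [Finset.sum_comm]
  refine Finset.sum_congr rfl fun i _ => Finset.sum_congr rfl fun j _ => ?_
  simp [mul_comm]

/-- Peeling off one factor, ∏(f+g) − ∏f splits as f · (the same difference for the remaining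
factors) + g · ∏(f+g); both terms are Hadamard products of positive kernels. -/
theorem prod_gram_add_posSemidef {f g : V →ₗ⋆[ℂ] V →ₗ[ℂ] ℂ} (hf : IsPosHermitian f)
    (hg : IsPosHermitian g) {k : ℕ} (s : Finset (Fin k)) :
    (Matrix.of fun x y : Fin k → V =>
      ∏ m ∈ s, (f + g) (x m) (y m) - ∏ m ∈ s, f (x m) (y m)).PosSemidef := by
  classical
  induction s using Finset.induction_on with
  | empty =>
    simp only [Finset.prod_empty, sub_self]
    exact Matrix.PosSemidef.zero
  | insert a s ha ih =>
    have h : (Matrix.of fun x y : Fin k → V => ∏ m ∈ insert a s, (f + g) (x m) (y m) -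
          ∏ m ∈ insert a s, f (x m) (y m)) =
        (Matrix.of fun x y : Fin k → V => f (x a) (y a)).hadamard
          (Matrix.of fun x y : Fin k → V =>
            ∏ m ∈ s, (f + g) (x m) (y m) - ∏ m ∈ s, f (x m) (y m)) +
        (Matrix.of fun x y : Fin k → V => g (x a) (y a)).hadamard
          (Matrix.of fun x y : Fin k → V => ∏ m ∈ s, (f + g) (x m) (y m)) := by
      ext x y
      simp only [Finset.prod_insert ha, Matrix.of_apply, Matrix.add_apply, Matrix.hadamard_apply,
        LinearMap.add_apply]
      ring
    rw [h]
    exact ((gram_posSemidef hf fun x : Fin k → V => x a).hadamard ih).add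
      ((gram_posSemidef hg fun x : Fin k → V => x a).hadamard (prod_gram_posSemidef (hf.add hg) s))

theorem powForm_le_add {f g : V →ₗ⋆[ℂ] V →ₗ[ℂ] ℂ} (hf : IsPosHermitian f)
    (hg : IsPosHermitian g) (k : ℕ) (X : ⨂[ℂ]^k V) :
    (powForm f k X X).re ≤ (powForm (f + g) k X X).re := by
  obtain ⟨c, rfl⟩ := exists_eq_sum_tprod X
  have h := (prod_gram_add_posSemidef hf hg (Finset.univ : Finset (Fin k))).2 c
  rw [powForm_apply_sum hf k c fun x => x, powForm_apply_sum (hf.add hg) k c fun x => x,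
    ← sub_nonneg, ← Complex.sub_re]
  simp only [Matrix.of_apply, mul_sub, sub_mul, Finsupp.sum_sub] at h
  exact (Complex.nonneg_iff.1 h).1

theorem powForm_smul (f : V →ₗ⋆[ℂ] V →ₗ[ℂ] ℂ) (hf : IsPosHermitian f) {r : ℝ} (hr : 0 ≤ r)
    (k : ℕ) (X : ⨂[ℂ]^k V) :
    powForm ((r : ℂ) • f) k X X = (r : ℂ) ^ k * powForm f k X X := by
  obtain ⟨c, rfl⟩ := exists_eq_sum_tprod X
  rw [powForm_apply_sum hf k c fun x => x, powForm_apply_sum (hf.smul hr) k c fun x => x]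
  simp only [Finsupp.sum, Finset.mul_sum, LinearMap.smul_apply, smul_eq_mul,
    Finset.prod_mul_distrib, Finset.prod_const, Finset.card_univ, Fintype.card_fin]
  refine Finset.sum_congr rfl fun i _ => Finset.sum_congr rfl fun j _ => ?_
  ring

/-- The bilinear form `b` is a functional of norm at most one on `V ⊗ V` with the Hilbert seminorm
given by `f`, expressed through positivity of a kernel. -/
def Dominated (f : V →ₗ⋆[ℂ] V →ₗ[ℂ] ℂ) (b : LinearMap.BilinForm ℂ V) : Prop :=
  (Matrix.of fun p q : V × V =>
    f p.1 q.1 * f p.2 q.2 - conj (b p.1 p.2) * b q.1 q.2).PosSemidef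

/-- The kernel grows by f ⊗ g + g ⊗ (f + g), a sum of Hadamard products of positive kernels. This
makes room for an arbitrary further form next to the one that dominates `b`. -/
theorem Dominated.add {f g : V →ₗ⋆[ℂ] V →ₗ[ℂ] ℂ} {b : LinearMap.BilinForm ℂ V}
    (h : Dominated f b) (hf : IsPosHermitian f) (hg : IsPosHermitian g) : Dominated (f + g) b := by
  have h2 : (Matrix.of fun p q : V × V =>
      (f + g) p.1 q.1 * (f + g) p.2 q.2 - conj (b p.1 p.2) * b q.1 q.2) =
      (Matrix.of fun p q : V × V =>
        f p.1 q.1 * f p.2 q.2 - conj (b p.1 p.2) * b q.1 q.2) +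
      ((Matrix.of fun p q : V × V => f p.1 q.1).hadamard (Matrix.of fun p q : V × V => g p.2 q.2) +
      (Matrix.of fun p q : V × V => g p.1 q.1).hadamard
        (Matrix.of fun p q : V × V => (f + g) p.2 q.2)) := by
    ext p q
    simp only [Matrix.of_apply, Matrix.add_apply, Matrix.hadamard_apply, LinearMap.add_apply]
    ring
  rw [Dominated, h2]
  exact Matrix.PosSemidef.add h <| ((gram_posSemidef hf Prod.fst).hadamard (gram_posSemidef hg Prod.snd)).add
    ((gram_posSemidef hg Prod.fst).hadamard (gram_posSemidef (hf.add hg) Prod.snd))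

theorem Dominated.norm_apply_le {f : V →ₗ⋆[ℂ] V →ₗ[ℂ] ℂ} {b : LinearMap.BilinForm ℂ V}
    (h : Dominated f b) (hf : IsPosHermitian f) (v w : V) :
    ‖b v w‖ ≤ hf.seminorm v * hf.seminorm w := by
  have h1 := h.diag_nonneg (i := (v, w))
  simp only [Matrix.of_apply, hf.apply_self, Complex.conj_mul'] at h1
  rw [sub_nonneg] at h1
  have h2 : ‖b v w‖ ^ 2 ≤ (hf.seminorm v * hf.seminorm w) ^ 2 := by
    rw [mul_pow]
    exact_mod_cast h1
  exact (pow_le_pow_iff_left₀ (norm_nonneg _)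
    (mul_nonneg (apply_nonneg _ _) (apply_nonneg _ _)) two_ne_zero).1 h2

/-- The difference of the two sides is the quadratic form of a Hadamard product: the domination
kernel in the first two slots times the product kernel in the other k. -/
theorem Dominated.powForm_contractFirst_le {f : V →ₗ⋆[ℂ] V →ₗ[ℂ] ℂ} {b : LinearMap.BilinForm ℂ V}
    (h : Dominated f b) (hf : IsPosHermitian f) (k : ℕ) (X : ⨂[ℂ]^(k + 2) V) :
    (powForm f k (contractFirst b k X) (contractFirst b k X)).re ≤ (powForm f (k + 2) X X).re := by
  obtain ⟨c, rfl⟩ := exists_eq_sum_tprod X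
  have h1 := ((h.submatrix fun x : Fin (k + 2) → V => (x 0, x 1)).hadamard
    ((prod_gram_posSemidef hf (Finset.univ : Finset (Fin k))).submatrix
      fun (x : Fin (k + 2) → V) i => x i.succ.succ)).2 c
  have h2 : powForm f k (contractFirst b k (c.sum fun x a => a • PiTensorProduct.tprod ℂ x))
      (contractFirst b k (c.sum fun x a => a • PiTensorProduct.tprod ℂ x)) =
      c.sum fun i ci => c.sum fun j cj =>
        star ci * (conj (b (i 0) (i 1)) * b (j 0) (j 1) *
          ∏ m : Fin k, f (i m.succ.succ) (j m.succ.succ)) * cj := by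
    simp only [Finsupp.sum, map_sum, LinearMap.sum_apply, map_smulₛₗ, LinearMap.smul_apply,
      smul_eq_mul, contractFirst_tprod, powForm_tprod hf, Finset.mul_sum, RingHom.id_apply]
    rw [Finset.sum_comm]
    refine Finset.sum_congr rfl fun i _ => Finset.sum_congr rfl fun j _ => ?_
    simp only [Complex.star_def]
    ring
  rw [h2, powForm_apply_sum hf (k + 2) c fun x => x, ← sub_nonneg, ← Complex.sub_re]
  refine (Complex.nonneg_iff.1 (h1.trans_eq ?_)).1
  simp only [Finsupp.sum, ← Finset.sum_sub_distrib]
  refine Finset.sum_congr rfl fun i _ => Finset.sum_congr rfl fun j _ => ?_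
  simp only [Matrix.hadamard_apply, Matrix.submatrix_apply, Matrix.of_apply, Fin.prod_univ_succ,
    Fin.succ_zero_eq_one]
  ring

/-- A form of Hilbert–Schmidt type is a bounded functional on `V ⊗ V`. -/
theorem dominated_of_orthonormal {f : V →ₗ⋆[ℂ] V →ₗ[ℂ] ℂ} (hf : IsPosHermitian f)
    {b : LinearMap.BilinForm ℂ V}
    (h0 : ∀ v w, hf.seminorm v = 0 ∨ hf.seminorm w = 0 → b v w = 0)
    (h1 : ∀ (d : ℕ) (e : Fin d → V), (∀ i j, f (e i) (e j) = if i = j then 1 else 0) →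
      ∑ i, ∑ j, ‖b (e i) (e j)‖ ^ 2 ≤ 1) : Dominated f b := by
  classical
  refine ⟨?_, fun c => ?_⟩
  · ext p q
    simp [hf.conj_symm, mul_comm]
  -- Only finitely many vectors occur in `c`. Modulo null vectors, which neither `f` nor `b` sees,
  -- all of them expand in one orthonormal tuple.
  obtain ⟨d, e, he, hS⟩ := hf.exists_orthonormal
    (c.support.image Prod.fst ∪ c.support.image Prod.snd)
  have hl : ∀ p ∈ c.support, hf.seminorm (p.1 - ∑ i, f (e i) p.1 • e i) = 0 := fun p hp =>
    hS _ (Finset.mem_union_left _ (Finset.mem_image_of_mem _ hp))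
  have hr : ∀ p ∈ c.support, hf.seminorm (p.2 - ∑ i, f (e i) p.2 • e i) = 0 := fun p hp =>
    hS _ (Finset.mem_union_right _ (Finset.mem_image_of_mem _ hp))
  have hfe : ∀ v w, hf.seminorm (w - ∑ i, f (e i) w • e i) = 0 →
      f v w = ∑ i, conj (f (e i) v) * f (e i) w := by
    intro v w hw
    have h2 : f v (w - ∑ i, f (e i) w • e i) = 0 := by
      have := hf.norm_apply_le v (w - ∑ i, f (e i) w • e i)
      rw [hw, mul_zero] at this
      exact norm_le_zero_iff.1 this
    rw [map_sub, sub_eq_zero] at h2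
    rw [h2, map_sum]
    refine Finset.sum_congr rfl fun i _ => ?_
    rw [map_smul, smul_eq_mul, hf.conj_symm, mul_comm]
  have hbe : ∀ p ∈ c.support, b p.1 p.2 =
      ∑ i, ∑ j, b (e i) (e j) * (f (e i) p.1 * f (e j) p.2) := by
    intro p hp
    have h2 := h0 _ p.2 (Or.inl (hl p hp))
    rw [map_sub, LinearMap.sub_apply, sub_eq_zero] at h2
    have h3 := h0 (∑ i, f (e i) p.1 • e i) _ (Or.inr (hr p hp))
    rw [map_sub, sub_eq_zero] at h3
    rw [h2, h3]
    simp only [map_sum, LinearMap.sum_apply, map_smul, LinearMap.smul_apply, smul_eq_mul,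
      Finset.mul_sum]
    rw [Finset.sum_comm]
    refine Finset.sum_congr rfl fun i _ => Finset.sum_congr rfl fun j _ => ?_
    ring
  -- The coordinates, in the basis eᵢ ⊗ eⱼ, of the tensor with coefficients `c`.
  let a : Fin d → Fin d → ℂ := fun i j => ∑ p ∈ c.support, c p * (f (e i) p.1 * f (e j) p.2)
  have hB : ∑ p ∈ c.support, c p * b p.1 p.2 = ∑ i, ∑ j, b (e i) (e j) * a i j := by
    calc _ = ∑ p ∈ c.support, ∑ i, ∑ j, c p * (b (e i) (e j) * (f (e i) p.1 * f (e j) p.2)) :=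
          Finset.sum_congr rfl fun p hp => by rw [hbe p hp]; simp only [Finset.mul_sum]
      _ = _ := by
          rw [Finset.sum_comm]
          refine Finset.sum_congr rfl fun i _ => ?_
          rw [Finset.sum_comm]
          refine Finset.sum_congr rfl fun j _ => ?_
          simp only [a, Finset.mul_sum]
          exact Finset.sum_congr rfl fun p _ => by ring
  have hA : ∑ p ∈ c.support, ∑ q ∈ c.support, star (c p) * (f p.1 q.1 * f p.2 q.2) * c q =
      ∑ i, ∑ j, conj (a i j) * a i j := by
    calc _ = ∑ p ∈ c.support, ∑ q ∈ c.support, ∑ i, ∑ j,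
          conj (c p * (f (e i) p.1 * f (e j) p.2)) * (c q * (f (e i) q.1 * f (e j) q.2)) := by
          refine Finset.sum_congr rfl fun p hp => Finset.sum_congr rfl fun q hq => ?_
          rw [hfe _ _ (hl q hq), hfe _ _ (hr q hq), Finset.sum_mul_sum]
          simp only [Finset.mul_sum, Finset.sum_mul, map_mul, Complex.star_def]
          exact Finset.sum_congr rfl fun i _ => Finset.sum_congr rfl fun j _ => by ring
      _ = _ := by
          simp only [a, map_sum, Finset.sum_mul_sum]
          rw [Finset.sum_congr rfl fun p _ => Finset.sum_comm, Finset.sum_comm]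
          refine Finset.sum_congr rfl fun i _ => ?_
          rw [Finset.sum_congr rfl fun p _ => Finset.sum_comm, Finset.sum_comm]
  -- Cauchy–Schwarz on pairs of indices; the Hilbert–Schmidt bound makes the factor coming from `b`
  -- at most one.
  have hCS : ‖∑ i, ∑ j, b (e i) (e j) * a i j‖ ^ 2 ≤ ∑ i, ∑ j, ‖a i j‖ ^ 2 := by
    have h2 := Finset.sum_mul_sq_le_sq_mul_sq (Finset.univ : Finset (Fin d × Fin d))
      (fun p => ‖b (e p.1) (e p.2)‖) (fun p => ‖a p.1 p.2‖)
    simp only [Fintype.sum_prod_type] at h2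
    refine le_trans ?_ (h2.trans (mul_le_of_le_one_left (by positivity) (h1 d e he)))
    gcongr
    refine (norm_sum_le _ _).trans (Finset.sum_le_sum fun i _ => (norm_sum_le _ _).trans ?_)
    simp
  have hgoal : (c.sum fun i ci => c.sum fun j cj => star ci *
      (Matrix.of fun p q : V × V => f p.1 q.1 * f p.2 q.2 - conj (b p.1 p.2) * b q.1 q.2) i j *
        cj) = ((∑ i, ∑ j, ‖a i j‖ ^ 2 - ‖∑ i, ∑ j, b (e i) (e j) * a i j‖ ^ 2 : ℝ) : ℂ) := by
    push_cast
    simp only [← Complex.conj_mul']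
    rw [← hA, ← hB]
    simp only [Finsupp.sum, map_sum, Finset.sum_mul_sum, ← Finset.sum_sub_distrib]
    refine Finset.sum_congr rfl fun i _ => Finset.sum_congr rfl fun j _ => ?_
    simp only [Matrix.of_apply, map_mul, Complex.star_def]
    ring
  rw [hgoal]
  exact_mod_cast sub_nonneg.2 hCS

end Kernels

/-! ### Norm estimates for powers of the Laplace operator -/

section Estimates

variable {V : Type*} [AddCommGroup V] [Module ℂ V]

theorem exists_forall_ge_apply_eq_zero (X : Tens V) : ∃ n, ∀ k, n ≤ k → X k = 0 := by
  classical
  refine ⟨(DFinsupp.support X).sup id + 1, fun k hk => ?_⟩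
  by_contra h
  have := Finset.le_sup (f := id) (DFinsupp.mem_support_iff.2 h)
  simp only [id] at this
  omega

theorem extForm_seminorm_sq {f : V →ₗ⋆[ℂ] V →ₗ[ℂ] ℂ} (hf : IsPosHermitian f) (X : Tens V) {n : ℕ}
    (hn : ∀ k, n ≤ k → X k = 0) : (extForm_isPosHermitian hf).seminorm X ^ 2 =
      ∑ k ∈ Finset.range n, (k.factorial : ℝ) * (powForm f k (X k) (X k)).re := by
  rw [IsPosHermitian.seminorm_sq, extForm_apply f X X (Finset.range n)
    fun k hk => hn k (by simpa using hk), Complex.re_sum]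
  refine Finset.sum_congr rfl fun k _ => ?_
  rw [← Complex.ofReal_natCast, Complex.re_ofReal_mul]

theorem laplace_apply (b : LinearMap.BilinForm ℂ V) (X : Tens V) (k : ℕ) :
    laplace b X k = (((k + 2 : ℂ) * (k + 1)) / 2) • contractFirst b k (X (k + 2)) := by
  have h : DirectSum.component ℂ ℕ (fun k => ⨂[ℂ]^k V) k ∘ₗ laplace b =
      (((k + 2 : ℂ) * (k + 1)) / 2) • (contractFirst b k ∘ₗ
        DirectSum.component ℂ ℕ (fun k => ⨂[ℂ]^k V) (k + 2)) := by
    refine DirectSum.linearMap_ext (R := ℂ) fun j => LinearMap.ext fun x => ?_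
    simp only [LinearMap.comp_apply, laplace, DirectSum.toModule_lof, LinearMap.smul_apply]
    match j with
    | 0 => simp [laplaceDeg, DirectSum.component.of]
    | 1 => simp [laplaceDeg, DirectSum.component.of]
    | j + 2 =>
      by_cases hj : j = k
      · subst hj
        simp [laplaceDeg]
      · simp [laplaceDeg, DirectSum.component.of, hj]
  exact LinearMap.congr_fun h X

/-- Both binomial coefficients in (k+2t)! = C(k+2t, 2t) k! C(2t, t) t!² are bounded by powers of
two. -/
theorem factorial_add_two_mul_le (k t : ℕ) :
    (k + 2 * t).factorial ≤ k.factorial * (t.factorial ^ 2 * 4 ^ t * 2 ^ (k + 2 * t)) := by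
  have h1 := Nat.add_choose_mul_factorial_mul_factorial k (2 * t)
  have h2 := Nat.add_choose_mul_factorial_mul_factorial t t
  have h3 : (k + 2 * t).choose (2 * t) ≤ 2 ^ (k + 2 * t) := Nat.choose_le_two_pow _ _
  have h4 : (t + t).choose t ≤ 4 ^ t := by
    refine (Nat.choose_le_two_pow _ _).trans_eq ?_
    rw [← two_mul, pow_mul]
    norm_num
  rw [← two_mul] at h2 h4
  rw [← h1, ← h2]
  calc _ ≤ 2 ^ (k + 2 * t) * k.factorial * (4 ^ t * t.factorial * t.factorial) := by gcongr
    _ = _ := by ring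

/-- Every contraction is norm-nonincreasing, and the degree factors (j+2)(j+1)/2 telescope to
(k+2t)!/(k! 2^t). -/
theorem Dominated.powForm_laplace_pow_le {f : V →ₗ⋆[ℂ] V →ₗ[ℂ] ℂ} {b : LinearMap.BilinForm ℂ V}
    (h : Dominated f b) (hf : IsPosHermitian f) (X : Tens V) (t k : ℕ) :
    (powForm f k ((laplace b ^ t) X k) ((laplace b ^ t) X k)).re ≤
      (((k + 2 * t).factorial : ℝ) / (k.factorial * 2 ^ t)) ^ 2 *
        (powForm f (k + 2 * t) (X (k + 2 * t)) (X (k + 2 * t))).re := by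
  induction t generalizing k with
  | zero => simp [Nat.cast_ne_zero.2 k.factorial_ne_zero]
  | succ t ih =>
    rw [pow_succ', Module.End.mul_apply, laplace_apply]
    have h1 : ∀ c : ℝ, ∀ x : ⨂[ℂ]^k V, (powForm f k ((c : ℂ) • x) ((c : ℂ) • x)).re =
        c ^ 2 * (powForm f k x x).re := by
      intro c x
      simp only [map_smulₛₗ, LinearMap.smul_apply, smul_eq_mul, Complex.conj_ofReal,
        RingHom.id_apply, Complex.re_ofReal_mul]
      ring
    have h2 : (((k + 2 : ℂ) * (k + 1)) / 2) = (((k + 2) * (k + 1) / 2 : ℝ) : ℂ) := by push_cast; rfl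
    rw [h2, h1]
    refine (mul_le_mul_of_nonneg_left ((h.powForm_contractFirst_le hf k _).trans (ih (k + 2)))
      (sq_nonneg _)).trans_eq ?_
    rw [show k + 2 * (t + 1) = k + 2 + 2 * t by ring, ← mul_assoc, ← mul_pow]
    congr 2
    rw [Nat.factorial_succ (k + 1), Nat.factorial_succ k]
    have := Nat.cast_ne_zero (R := ℝ).2 k.factorial_ne_zero
    push_cast
    field_simp
    ring

/-- The central estimate. By `factorial_add_two_mul_le` the excess over t!² is 4^t 2^(k+2t) in the
squared norm: the first factor cancels against the halves in Δ_b, the second is paid for by doubling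
the form. The lowered degree leaves r^k in place of r^(k+2t), whence the factor r^(-t) for the norm
itself. -/
theorem Dominated.seminorm_laplace_pow_le {f : V →ₗ⋆[ℂ] V →ₗ[ℂ] ℂ} {b : LinearMap.BilinForm ℂ V}
    (h : Dominated f b) (hf : IsPosHermitian f) {r : ℝ} (hr : 0 < r) (X : Tens V) (t : ℕ) :
    (extForm_isPosHermitian (hf.smul hr.le)).seminorm ((laplace b ^ t) X) ≤
      t.factorial * r⁻¹ ^ t *
        (extForm_isPosHermitian (hf.smul (mul_pos two_pos hr).le)).seminorm X := by
  obtain ⟨n, hn⟩ := exists_forall_ge_apply_eq_zero ((laplace b ^ t) X)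
  obtain ⟨m, hm⟩ := exists_forall_ge_apply_eq_zero X
  have hs : ∀ (c : ℝ) (hc : 0 ≤ c) (k : ℕ) (x : ⨂[ℂ]^k V),
      (powForm ((c : ℂ) • f) k x x).re = c ^ k * (powForm f k x x).re := by
    intro c hc k x
    rw [powForm_smul f hf hc, ← Complex.ofReal_pow, Complex.re_ofReal_mul]
  refine (pow_le_pow_iff_left₀ (apply_nonneg _ _) (by positivity) two_ne_zero).1 ?_
  -- The range for X is taken long enough to contain every shifted degree k + 2t with k < n.
  rw [mul_pow, extForm_seminorm_sq (hf.smul hr.le) _ hn,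
    extForm_seminorm_sq (hf.smul (mul_pos two_pos hr).le) X (n := (n + m) + 2 * t)
      fun k hk => hm k (by omega)]
  have hg : ∀ k, 0 ≤ (powForm f k (X k) (X k)).re := fun k =>
    (powForm_isPosHermitian hf k).nonneg _
  calc _ ≤ ∑ k ∈ Finset.range n, (t.factorial * r⁻¹ ^ t) ^ 2 * (((k + 2 * t).factorial : ℝ) *
        ((2 * r) ^ (k + 2 * t) * (powForm f (k + 2 * t) (X (k + 2 * t)) (X (k + 2 * t))).re)) := by
        refine Finset.sum_le_sum fun k _ => ?_
        rw [hs r hr.le]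
        refine (mul_le_mul_of_nonneg_left (mul_le_mul_of_nonneg_left
          (h.powForm_laplace_pow_le hf X t k) (by positivity)) (by positivity)).trans ?_
        simp only [← mul_assoc]
        refine mul_le_mul_of_nonneg_right ?_ (hg _)
        have h1 : ((k + 2 * t).factorial : ℝ) ≤
            k.factorial * (t.factorial ^ 2 * 4 ^ t * 2 ^ (k + 2 * t)) := by
          exact_mod_cast factorial_add_two_mul_le k t
        have h2 : (0 : ℝ) < k.factorial := by exact_mod_cast k.factorial_pos
        have h3 : (2 ^ t : ℝ) ^ 2 = 4 ^ t := by rw [← pow_mul, mul_comm, pow_mul]; norm_num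
        calc (k.factorial : ℝ) * r ^ k * ((k + 2 * t).factorial / (k.factorial * 2 ^ t)) ^ 2
            = (r ^ k * (k + 2 * t).factorial / (k.factorial * 4 ^ t)) *
                (k + 2 * t).factorial := by
              rw [div_pow, mul_pow, h3]
              field_simp
          _ ≤ (r ^ k * (k + 2 * t).factorial / (k.factorial * 4 ^ t)) *
                (k.factorial * (t.factorial ^ 2 * 4 ^ t * 2 ^ (k + 2 * t))) := by gcongr
          _ = _ := by
              rw [mul_pow, mul_pow 2 r, pow_add r, inv_pow, inv_pow, ← pow_mul, mul_comm t 2]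
              field_simp
    _ = (t.factorial * r⁻¹ ^ t) ^ 2 * ∑ k ∈ Finset.range n, (((k + 2 * t).factorial : ℝ) *
        ((2 * r) ^ (k + 2 * t) * (powForm f (k + 2 * t) (X (k + 2 * t)) (X (k + 2 * t))).re)) := by
        rw [Finset.mul_sum]
    _ ≤ _ := by
        refine mul_le_mul_of_nonneg_left ?_ (sq_nonneg _)
        simp only [hs _ (mul_pos two_pos hr).le]
        have hsub : Finset.range n ⊆ Finset.range (n + m) :=
          Finset.range_mono (Nat.le_add_right n m)
        refine (Finset.sum_le_sum_of_subset_of_nonneg hsub fun k _ _ => ?_).trans ?_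
        · have := hg (k + 2 * t)
          positivity
        -- The shifted sum is the full sum without its first 2t terms, which are nonnegative.
        · rw [add_comm (n + m) (2 * t), Finset.sum_range_add _ (2 * t)]
          refine le_trans (le_of_eq (Finset.sum_congr rfl fun k _ => ?_))
            (le_add_of_nonneg_left (Finset.sum_nonneg fun k _ => ?_))
          · rw [add_comm k]
          · have := hg k
            positivity

theorem seminorm_ext_le_add {f g : V →ₗ⋆[ℂ] V →ₗ[ℂ] ℂ} (hf : IsPosHermitian f)
    (hg : IsPosHermitian g) (X : Tens V) :
    (extForm_isPosHermitian hf).seminorm X ≤ (extForm_isPosHermitian (hf.add hg)).seminorm X := by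
  obtain ⟨n, hn⟩ := exists_forall_ge_apply_eq_zero X
  refine (pow_le_pow_iff_left₀ (apply_nonneg _ _) (apply_nonneg _ _) two_ne_zero).1 ?_
  rw [extForm_seminorm_sq hf _ hn, extForm_seminorm_sq (hf.add hg) _ hn]
  exact Finset.sum_le_sum fun k _ =>
    mul_le_mul_of_nonneg_left (powForm_le_add hf hg k _) (Nat.cast_nonneg _)

end Estimates

/-! ### Directed seminorms and continuity of the exponential -/

section Continuity

variable {V : Type*} [AddCommGroup V] [Module ℂ V] [TopologicalSpace V]

/-- The sum of two continuous positive Hermitian forms. -/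
def ContForm.add (α β : ContForm V) : ContForm V where
  form := α.form + β.form
  isPosHermitian := α.isPosHermitian.add β.isPosHermitian
  continuous_form := α.continuous_form.add β.continuous_form

/-- A nonnegative multiple of a continuous positive Hermitian form. -/
def ContForm.smul (r : ℝ) (hr : 0 ≤ r) (α : ContForm V) : ContForm V where
  form := (r : ℂ) • α.form
  isPosHermitian := α.isPosHermitian.smul hr
  continuous_form := continuous_const.mul α.continuous_form

theorem tensSeminorms_le_add_left (α β : ContForm V) (X : Tens V) :
    tensSeminorms V α X ≤ tensSeminorms V (α.add β) X :=
  seminorm_ext_le_add α.isPosHermitian β.isPosHermitian X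

theorem tensSeminorms_le_add_right (α β : ContForm V) (X : Tens V) :
    tensSeminorms V β X ≤ tensSeminorms V (α.add β) X := by
  have h : α.add β = β.add α := by
    simp only [ContForm.add, add_comm]
  rw [h]
  exact tensSeminorms_le_add_left β α X

/-- The seminorms increase when forms are added, so the family is directed and a single form
controls any continuous seminorm up to a constant. -/
theorem exists_sup_tensSeminorms_le (s : Finset (ContForm V)) :
    ∃ γ, s.sup (tensSeminorms V) ≤ tensSeminorms V γ := by
  classical
  induction s using Finset.induction_on with
  | empty => exact ⟨Classical.arbitrary _, by simp⟩
  | insert α s _ ih =>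
    obtain ⟨γ, hγ⟩ := ih
    refine ⟨α.add γ, ?_⟩
    rw [Finset.sup_insert]
    exact sup_le (tensSeminorms_le_add_left α γ)
      (hγ.trans (tensSeminorms_le_add_right α γ))

theorem IsHilbertSchmidt.exists_dominated {b : LinearMap.BilinForm ℂ V} (hb : IsHilbertSchmidt b) :
    ∃ α : ContForm V, Dominated α.form b := by
  obtain ⟨α, h0, h1⟩ := hb
  exact ⟨α, dominated_of_orthonormal α.isPosHermitian h0 h1⟩

theorem IsHilbertSchmidt.neg {b : LinearMap.BilinForm ℂ V} (hb : IsHilbertSchmidt b) :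
    IsHilbertSchmidt (-b) := by
  obtain ⟨α, h0, h1⟩ := hb
  exact ⟨α, fun v w h => by simp [h0 v w h], fun d e he => by simpa using h1 d e he⟩

/-- Since δ = α + rβ still dominates `b`, the central estimate applies to r⁻¹δ and yields the factor
r^t. Scaling by r first ensures that r⁻¹δ contains the whole of β. -/
theorem IsHilbertSchmidt.exists_laplace_pow_le {b : LinearMap.BilinForm ℂ V}
    (hb : IsHilbertSchmidt b) (β : ContForm V) {r : ℝ} (hr : 0 < r) :
    ∃ γ : ContForm V, ∀ (t : ℕ) (X : Tens V),
      tensSeminorms V β ((laplace b ^ t) X) ≤ t.factorial * r ^ t * tensSeminorms V γ X := by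
  obtain ⟨α, hα⟩ := hb.exists_dominated
  have hr' : 0 < r⁻¹ := inv_pos.2 hr
  let δ := α.add (β.smul r hr.le)
  have hδ : Dominated δ.form b :=
    hα.add α.isPosHermitian (β.smul r hr.le).isPosHermitian
  refine ⟨δ.smul (2 * r⁻¹) (mul_pos two_pos hr').le, fun t X => ?_⟩
  have h1 := hδ.seminorm_laplace_pow_le δ.isPosHermitian hr' X t
  rw [inv_inv] at h1
  refine le_trans ?_ h1
  have h2 : δ.smul r⁻¹ hr'.le = (α.smul r⁻¹ hr'.le).add β := by
    simp only [δ, ContForm.smul, ContForm.add, smul_add, smul_smul]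
    congr 2
    rw [← Complex.ofReal_mul, inv_mul_cancel₀ hr.ne', Complex.ofReal_one, one_smul]
  change _ ≤ tensSeminorms V (δ.smul r⁻¹ hr'.le) _
  rw [h2]
  exact tensSeminorms_le_add_right _ _ _

theorem LocallyNilpotent.exp_apply_eq_sum {E : Type*} [AddCommMonoid E] [Module ℂ E]
    {D : E →ₗ[ℂ] E} (hD : LocallyNilpotent D) {X : E} {N : ℕ} (hN : (D ^ N) X = 0) :
    hD.exp X = ∑ t ∈ Finset.range N, ((t.factorial : ℂ)⁻¹) • (D ^ t) X := by
  refine finsum_eq_sum_of_support_subset _ fun t ht => ?_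
  by_contra h
  exact ht (by simp [pow_apply_eq_zero_of_le hN (by simpa using h)])

theorem continuous_of_le_tensSeminorms {T : Tens V →ₗ[ℂ] Tens V}
    (h : ∀ β, ∃ (C : NNReal) (γ : ContForm V), ∀ X,
      tensSeminorms V β (T X) ≤ C * tensSeminorms V γ X) : Continuous T := by
  refine WithSeminorms.continuous_of_isBounded withSeminorms_tens withSeminorms_tens T fun β => ?_
  obtain ⟨C, γ, h⟩ := h β
  exact ⟨{γ}, C, fun X => by simpa [NNReal.smul_def] using h X⟩

theorem IsHilbertSchmidt.continuous_expLaplace {b : LinearMap.BilinForm ℂ V}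
    (hb : IsHilbertSchmidt b) : Continuous (expLaplace b) := by
  refine continuous_of_le_tensSeminorms fun β => ?_
  -- With r = 1/2 the exponential series is dominated by a geometric series of sum 2, the constant
  -- used next.
  obtain ⟨γ, hγ⟩ := hb.exists_laplace_pow_le β (r := 1 / 2) (by norm_num)
  refine ⟨2, γ, fun X => ?_⟩
  obtain ⟨N, hN⟩ := laplace_locallyNilpotent b X
  rw [expLaplace, LocallyNilpotent.exp_apply_eq_sum _ hN]
  refine (Finset.le_sum_of_subadditive _ (map_zero _).le (map_add_le_add _) _ _).trans ?_
  calc _ ≤ ∑ t ∈ Finset.range N, (1 / 2 : ℝ) ^ t * tensSeminorms V γ X := by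
        refine Finset.sum_le_sum fun t _ => ?_
        have ht : (0 : ℝ) < t.factorial := by exact_mod_cast t.factorial_pos
        rw [map_smul_eq_mul, norm_inv, Complex.norm_natCast, inv_mul_le_iff₀ ht, ← mul_assoc]
        exact hγ t X
    _ ≤ _ := by
        rw [← Finset.sum_mul]
        refine mul_le_mul_of_nonneg_right ?_ (apply_nonneg _ _)
        exact sum_geometric_two_le N

theorem IsHilbertSchmidt.continuous_laplace {b : LinearMap.BilinForm ℂ V}
    (hb : IsHilbertSchmidt b) : Continuous (laplace b) := by
  refine continuous_of_le_tensSeminorms fun β => ?_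
  obtain ⟨γ, hγ⟩ := hb.exists_laplace_pow_le β one_pos
  exact ⟨1, γ, fun X => by simpa using hγ 1 X⟩

theorem continuous_expLaplaceSym {b : LinearMap.BilinForm ℂ V}
    (h : Continuous (expLaplace b)) : Continuous (expLaplaceSym b) :=
  (h.comp continuous_subtype_val).subtype_mk _

theorem IsHilbertSchmidt.continuous_laplaceSym {b : LinearMap.BilinForm ℂ V}
    (hb : IsHilbertSchmidt b) : Continuous (laplaceSym b) :=
  (hb.continuous_laplace.comp continuous_subtype_val).subtype_mk _

/-- The restrictions of the seminorms of the tensor algebra to the symmetric tensors. -/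
def symSeminorms (V : Type*) [AddCommGroup V] [Module ℂ V] [TopologicalSpace V] :
    SeminormFamily ℂ (SymTens V) (ContForm V) :=
  (tensSeminorms V).comp (SymTens V).subtype

theorem withSeminorms_symTens : WithSeminorms (symSeminorms V) :=
  Topology.IsInducing.withSeminorms withSeminorms_tens Topology.IsInducing.subtypeVal

theorem exists_le_symSeminorms {q : Seminorm ℂ (SymTens V)} (hq : Continuous q) :
    ∃ C : NNReal, 0 < C ∧ ∃ γ : ContForm V, ∀ X, q X ≤ C * symSeminorms V γ X := by
  obtain ⟨s, C, hC, h⟩ := Seminorm.bound_of_continuous withSeminorms_symTens q hq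
  obtain ⟨γ, hγ⟩ := exists_sup_tensSeminorms_le s
  refine ⟨C, pos_iff_ne_zero.2 hC, γ, fun X => (h X).trans ?_⟩
  rw [smul_apply, NNReal.smul_def, smul_eq_mul]
  refine mul_le_mul_of_nonneg_left ?_ C.2
  rw [symSeminorms, ← SeminormFamily.finset_sup_comp]
  exact hγ X

end Continuity

/-! ### Continuity forces the Hilbert–Schmidt property -/

section Converse

variable {V : Type*} [AddCommGroup V] [Module ℂ V]

theorem powForm_permute {f : V →ₗ⋆[ℂ] V →ₗ[ℂ] ℂ} (hf : IsPosHermitian f) {k : ℕ}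
    (σ : Equiv.Perm (Fin k)) (X : ⨂[ℂ]^k V) :
    powForm f k (permute σ X) (permute σ X) = powForm f k X X := by
  obtain ⟨c, rfl⟩ := exists_eq_sum_tprod X
  have h : permute σ (c.sum fun x a => a • PiTensorProduct.tprod ℂ x) =
      c.sum fun x a => a • PiTensorProduct.tprod ℂ fun i => x (σ i) := by
    simp [Finsupp.sum, permute_tprod]
  rw [h, powForm_apply_sum hf k c fun x i => x (σ i), powForm_apply_sum hf k c fun x => x]
  refine Finset.sum_congr rfl fun x _ => Finset.sum_congr rfl fun y _ => ?_
  beta_reduce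
  rw [Equiv.prod_comp σ fun m => f (x m) (y m)]

/-- Symmetrisation is an average of permutations, and these are isometric. -/
theorem seminorm_symPow_le {f : V →ₗ⋆[ℂ] V →ₗ[ℂ] ℂ} (hf : IsPosHermitian f) {k : ℕ}
    (X : ⨂[ℂ]^k V) :
    (powForm_isPosHermitian hf k).seminorm (symPow k X) ≤
      (powForm_isPosHermitian hf k).seminorm X := by
  have hk : (0 : ℝ) < k.factorial := by exact_mod_cast k.factorial_pos
  rw [symPow, LinearMap.smul_apply, map_smul_eq_mul, norm_inv, Complex.norm_natCast,
    inv_mul_le_iff₀ hk, LinearMap.sum_apply]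
  refine (Finset.le_sum_of_subadditive _ (map_zero _).le (map_add_le_add _) _ _).trans ?_
  simp [IsPosHermitian.seminorm_apply, powForm_permute hf, Fintype.card_perm]

/-- Because `b` is symmetric, its contraction does not see the antisymmetric part; a bound on
symmetric tensors therefore controls all of V ⊗ V. -/
theorem contractFirst_symPow_two {b : LinearMap.BilinForm ℂ V} (hb : ∀ v w, b v w = b w v)
    (x : ⨂[ℂ]^2 V) : contractFirst b 0 (symPow 2 x) = contractFirst b 0 x := by
  have h : ∀ σ : Equiv.Perm (Fin 2), contractFirst b 0 (permute σ x) = contractFirst b 0 x := by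
    intro σ
    have h : contractFirst b 0 ∘ₗ permute σ = contractFirst b 0 := by
      ext x
      simp only [LinearMap.compMultilinearMap_apply, LinearMap.comp_apply, permute_tprod,
        contractFirst_tprod]
      congr 1
      · by_cases h0 : σ 0 = 0
        · have h1 : σ 1 = 1 := by
            have := σ.injective.ne (show (0 : Fin 2) ≠ 1 by decide)
            omega
          rw [h0, h1]
        · have h0 : σ 0 = 1 := by omega
          have h1 : σ 1 = 0 := by
            have := σ.injective.ne (show (0 : Fin 2) ≠ 1 by decide)
            omega
          rw [h0, h1, hb]
      · congr 1
        exact funext fun i => i.elim0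
    exact LinearMap.congr_fun h x
  simp only [symPow, LinearMap.smul_apply, LinearMap.sum_apply, map_smul, map_sum, h]
  simp [Fintype.card_perm, ← Nat.cast_smul_eq_nsmul ℂ, smul_smul]

theorem expLaplace_incl_two_apply_zero (b : LinearMap.BilinForm ℂ V) (x : ⨂[ℂ]^2 V) :
    expLaplace b (incl 2 x) 0 = contractFirst b 0 x := by
  have h1 : laplace b (incl 2 x) = incl 0 (contractFirst b 0 x) := by
    rw [laplace, DirectSum.toModule_lof]
    simp [laplaceDeg]
  have h2 : (laplace b ^ 2) (incl 2 x) = 0 := by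
    rw [pow_two, Module.End.mul_apply, h1, laplace, DirectSum.toModule_lof]
    rfl
  rw [expLaplace, LocallyNilpotent.exp_apply_eq_sum _ h2, Finset.sum_range_succ,
    Finset.sum_range_one, pow_zero, pow_one, h1]
  have h3 : (incl 2 x : Tens V) 0 = 0 := DirectSum.of_eq_of_ne _ _ _ (by decide)
  have h4 : (incl 0 (contractFirst b 0 x) : Tens V) 0 = contractFirst b 0 x :=
    DirectSum.of_eq_same _ _
  simp [DirectSum.add_apply, h3, h4]

/-- Duality: at the tensor whose coefficients are conj b(eᵢ, eⱼ), both the functional and the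
squared norm equal s = ∑ |b(eᵢ, eⱼ)|². The hypothesis reads s² ≤ s, hence s ≤ 1. Pure tensors give
the vanishing on null vectors. -/
theorem isHilbertSchmidt_of_contractFirst_le [TopologicalSpace V] {b : LinearMap.BilinForm ℂ V}
    (α : ContForm V) (h : ∀ x : ⨂[ℂ]^2 V,
      (powForm α.form 0 (contractFirst b 0 x) (contractFirst b 0 x)).re ≤
        (powForm α.form 2 x x).re) : IsHilbertSchmidt b := by
  have h0 : ∀ {ι : Type} (c : ι →₀ ℂ) (x : ι → Fin 2 → V),
      (powForm α.form 0 (contractFirst b 0 (c.sum fun i a => a • PiTensorProduct.tprod ℂ (x i)))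
        (contractFirst b 0 (c.sum fun i a => a • PiTensorProduct.tprod ℂ (x i)))).re =
      ‖c.sum fun i a => a * b (x i 0) (x i 1)‖ ^ 2 := by
    intro ι c x
    have h1 : contractFirst b 0 (c.sum fun i a => a • PiTensorProduct.tprod ℂ (x i)) =
        (c.sum fun i a => a * b (x i 0) (x i 1)) • PiTensorProduct.tprod ℂ Fin.elim0 := by
      simp only [Finsupp.sum, map_sum, map_smul, contractFirst_tprod, Finset.sum_smul, mul_smul]
      refine Finset.sum_congr rfl fun i _ => ?_
      congr 3
      exact funext fun i => i.elim0
    rw [h1]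
    simp only [map_smulₛₗ, LinearMap.smul_apply, powForm_tprod α.isPosHermitian]
    simp [← Complex.ofReal_pow, Complex.mul_conj']
  have hbound : ∀ v w, ‖b v w‖ ^ 2 ≤
      (hilbertSeminorms V α v * hilbertSeminorms V α w) ^ 2 := by
    intro v w
    have h1 := h (PiTensorProduct.tprod ℂ ![v, w])
    have h2 := h0 (Finsupp.single () 1) fun _ => ![v, w]
    simp only [Finsupp.sum_single_index, zero_smul, zero_mul, one_smul, one_mul] at h2
    rw [h2, powForm_tprod α.isPosHermitian] at h1
    refine h1.trans_eq ?_
    simp only [Fin.prod_univ_two, Matrix.cons_val_zero, Matrix.cons_val_one]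
    rw [α.isPosHermitian.apply_self, α.isPosHermitian.apply_self, ← Complex.ofReal_mul,
      Complex.ofReal_re, mul_pow]
    rfl
  refine ⟨α, fun v w hvw => ?_, fun d e he => ?_⟩
  · have h1 := hbound v w
    rw [mul_eq_zero.2 hvw] at h1
    have h2 : ‖b v w‖ ^ 2 = 0 := le_antisymm (by simpa using h1) (sq_nonneg _)
    simpa using h2
  · let c : Fin d × Fin d →₀ ℂ := Finsupp.equivFunOnFinite.symm fun p => conj (b (e p.1) (e p.2))
    let x : Fin d × Fin d → Fin 2 → V := fun p => ![e p.1, e p.2]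
    have h1 := h (c.sum fun i a => a • PiTensorProduct.tprod ℂ (x i))
    rw [h0, powForm_apply_sum α.isPosHermitian] at h1
    set s := ∑ i, ∑ j, ‖b (e i) (e j)‖ ^ 2 with hs
    have h2 : (c.sum fun i a => a * b (x i 0) (x i 1)) = (s : ℂ) := by
      rw [Finsupp.sum_fintype _ _ (by simp), Fintype.sum_prod_type, hs]
      push_cast
      simp [c, x, Complex.conj_mul']
    have h3 : (c.sum fun i ci => c.sum fun j cj =>
        star ci * (∏ m, α.form (x i m) (x j m)) * cj) = (s : ℂ) := by
      have h4 : ∀ p q : Fin d × Fin d, ∏ m, α.form (x p m) (x q m) = if p = q then 1 else 0 := by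
        intro p q
        simp only [x, Fin.prod_univ_two, Matrix.cons_val_zero, Matrix.cons_val_one, he,
          Prod.ext_iff]
        split_ifs <;> simp_all
      simp only [h4]
      rw [Finsupp.sum_fintype _ _ (by simp)]
      have h5 : ∀ i, (c.sum fun j cj => star (c i) * (if i = j then 1 else 0) * cj) =
          star (c i) * c i := by
        intro i
        rw [Finsupp.sum_fintype _ _ (by simp)]
        simp
      simp only [h5]
      rw [Fintype.sum_prod_type, hs]
      push_cast
      simp [c, Complex.mul_conj']
    rw [h2, h3, Complex.norm_real, Complex.ofReal_re, Real.norm_eq_abs, sq_abs] at h1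
    nlinarith

theorem isHilbertSchmidt_of_continuous [TopologicalSpace V] {b : LinearMap.BilinForm ℂ V}
    (hb : ∀ v w, b v w = b w v) (h : Continuous (expLaplaceSym b)) : IsHilbertSchmidt b := by
  -- Any form serves here: only the scalar component is used, and in degree zero all forms agree.
  let δ : ContForm V := Classical.arbitrary _
  let q : Seminorm ℂ (SymTens V) := (symSeminorms V δ).comp (expLaplaceSym b)
  have hq : Continuous q := by
    rw [Seminorm.coe_comp]
    exact (withSeminorms_symTens.continuous_seminorm δ).comp h
  obtain ⟨C, hC, γ, hγ⟩ := exists_le_symSeminorms hq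
  -- In degree two, scaling by 2C multiplies the squared norm by 4C². This covers the 2C² needed,
  -- made of C² from the continuity bound and 2! from the weight.
  refine isHilbertSchmidt_of_contractFirst_le (γ.smul (2 * C) (by positivity)) fun x => ?_
  have h1 : incl 2 (symPow 2 x) ∈ SymTens V :=
    ⟨incl 2 x, by rw [symmetrizer, DirectSum.toModule_lof]; rfl⟩
  have h2 := hγ ⟨_, h1⟩
  change tensSeminorms V δ (expLaplace b (incl 2 (symPow 2 x))) ≤
    C * tensSeminorms V γ (incl 2 (symPow 2 x)) at h2
  have h3 : (powForm δ.form 0 (contractFirst b 0 x) (contractFirst b 0 x)).re ≤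
      tensSeminorms V δ (expLaplace b (incl 2 (symPow 2 x))) ^ 2 := by
    obtain ⟨n, hn⟩ := exists_forall_ge_apply_eq_zero (expLaplace b (incl 2 (symPow 2 x)))
    rw [tensSeminorms, extForm_seminorm_sq δ.isPosHermitian _ (n := n + 1)
      fun k hk => hn k (by omega), Finset.sum_range_succ']
    refine le_add_of_nonneg_of_le (Finset.sum_nonneg fun k _ => mul_nonneg (Nat.cast_nonneg _)
      ((powForm_isPosHermitian δ.isPosHermitian _).nonneg _)) ?_
    rw [expLaplace_incl_two_apply_zero, contractFirst_symPow_two hb]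
    simp
  have h4 : tensSeminorms V γ (incl 2 (symPow 2 x)) ^ 2 ≤ 2 * (powForm γ.form 2 x x).re := by
    have h5 : ∀ k, 3 ≤ k → (incl 2 (symPow 2 x) : Tens V) k = 0 :=
      fun k hk => DirectSum.of_eq_of_ne _ _ _ (by omega)
    rw [tensSeminorms, extForm_seminorm_sq γ.isPosHermitian _ h5, Finset.sum_range_succ,
      Finset.sum_eq_zero]
    · have h5 : (incl 2 (symPow 2 x) : Tens V) 2 = symPow 2 x := DirectSum.of_eq_same _ _
      rw [h5, zero_add]
      rw [Nat.factorial_two, Nat.cast_ofNat]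
      refine mul_le_mul_of_nonneg_left ?_ zero_le_two
      have h6 := seminorm_symPow_le γ.isPosHermitian x
      have h7 := pow_le_pow_left₀ (apply_nonneg _ _) h6 2
      rwa [IsPosHermitian.seminorm_sq, IsPosHermitian.seminorm_sq] at h7
    · intro k hk
      have h5 : (incl 2 (symPow 2 x) : Tens V) k = 0 :=
        DirectSum.of_eq_of_ne _ _ _ (by simp at hk; omega)
      simp [h5]
  have h5 : ∀ (f g : V →ₗ⋆[ℂ] V →ₗ[ℂ] ℂ), IsPosHermitian f → IsPosHermitian g →
      ∀ y : ⨂[ℂ]^0 V, powForm f 0 y y = powForm g 0 y y := by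
    intro f g hf hg y
    obtain ⟨c, rfl⟩ := exists_eq_sum_tprod y
    rw [powForm_apply_sum hf 0 c fun x => x, powForm_apply_sum hg 0 c fun x => x]
    simp
  rw [h5 _ δ.form (γ.smul _ _).isPosHermitian δ.isPosHermitian]
  refine h3.trans ((pow_le_pow_left₀ (apply_nonneg _ _) h2 2).trans ?_)
  change _ ≤ (powForm (((2 * C : ℝ) : ℂ) • γ.form) 2 x x).re
  rw [powForm_smul _ γ.isPosHermitian (by positivity), ← Complex.ofReal_pow,
    Complex.re_ofReal_mul, mul_pow]
  have h6 := (powForm_isPosHermitian γ.isPosHermitian 2).nonneg x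
  have h7 : (0 : ℝ) < C := hC
  nlinarith [mul_le_mul_of_nonneg_left h4 (sq_nonneg (C : ℝ)), mul_nonneg (sq_nonneg (C : ℝ)) h6]

end Converse

/-! ### Power series with rapidly decaying coefficients -/

section Series

open Filter Topology

variable {F : Type*} [AddCommGroup F] [Module ℂ F]

theorem seminorm_sum_le {κ : Type*} (q : Seminorm ℂ F) (s : Finset κ) (f : κ → F) :
    q (∑ k ∈ s, f k) ≤ ∑ k ∈ s, q (f k) :=
  Finset.le_sum_of_subadditive q (map_zero q).le (map_add_le_add q) s f

variable [UniformSpace F]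

/-- A sequence of vectors decaying faster than every geometric sequence, with respect to all
continuous seminorms. -/
def RapidlyDecaying (a : ℕ → F) : Prop :=
  ∀ q : Seminorm ℂ F, Continuous q → ∀ r : ℝ, 0 < r → ∃ C, 0 ≤ C ∧ ∀ t, q (a t) ≤ C * r ^ t

theorem RapidlyDecaying.exists_norm_mul_le {a : ℕ → F} (ha : RapidlyDecaying a) {q : Seminorm ℂ F}
    (hq : Continuous q) {R : ℝ} (hR : 0 < R) :
    ∃ g : ℕ → ℝ, Summable g ∧ (∀ t, 0 ≤ g t) ∧
      ∀ (t : ℕ) (c : ℂ) (s : ℝ), ‖c‖ ≤ s * R ^ t → q (c • a t) ≤ s * g t := by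
  -- Decay at rate 1/(2R) beats scalars of size R^t and leaves a geometric series of ratio 1/2.
  obtain ⟨C, hC0, hC⟩ := ha q hq (2 * R)⁻¹ (by positivity)
  refine ⟨fun t => C * (1 / 2) ^ t, summable_geometric_two.mul_left C, fun t => by positivity,
    fun t c s hc => ?_⟩
  rw [map_smul_eq_mul]
  refine (mul_le_mul hc (hC t) (apply_nonneg _ _) ((norm_nonneg c).trans hc)).trans_eq ?_
  rw [mul_inv, mul_pow, inv_pow R, one_div]
  field_simp

theorem RapidlyDecaying.summable_seminorm {a : ℕ → F} (ha : RapidlyDecaying a) (q : Seminorm ℂ F)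
    (hq : Continuous q) {c : ℕ → ℂ} {s R : ℝ} (hR : 0 < R) (hc : ∀ t, ‖c t‖ ≤ s * R ^ t) :
    Summable fun t => q (c t • a t) := by
  obtain ⟨g, hg, hg0, h⟩ := ha.exists_norm_mul_le hq hR
  exact Summable.of_nonneg_of_le (fun t => apply_nonneg _ _) (fun t => h t (c t) s (hc t))
    (hg.mul_left s)

theorem seminorm_tsum_le [T2Space F] {f : ℕ → F} {q : Seminorm ℂ F} (hq : Continuous q)
    (hf : Summable f) {g : ℕ → ℝ} (hg : Summable g) (h : ∀ t, q (f t) ≤ g t) :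
    q (∑' t, f t) ≤ ∑' t, g t := by
  have h1 : Tendsto (fun n => q (∑ t ∈ Finset.range n, f t)) atTop (𝓝 (q (∑' t, f t))) :=
    (hq.tendsto _).comp hf.hasSum.tendsto_sum_nat
  refine le_of_tendsto_of_tendsto' h1 hg.hasSum.tendsto_sum_nat fun n => ?_
  exact (seminorm_sum_le q _ f).trans (Finset.sum_le_sum fun t _ => h t)

variable {ι : Type*} {P : SeminormFamily ℂ F ι}

theorem WithSeminorms.rapidlyDecaying [Nonempty ι] (hP : WithSeminorms P) {a : ℕ → F}
    (h : ∀ i, ∀ r : ℝ, 0 < r → ∃ C, 0 ≤ C ∧ ∀ t, P i (a t) ≤ C * r ^ t) : RapidlyDecaying a := by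
  intro q hq r hr
  obtain ⟨s, K, -, hqs⟩ := Seminorm.bound_of_continuous hP q hq
  choose C hC0 hC using fun i => h i r hr
  refine ⟨K * ∑ i ∈ s, C i, mul_nonneg K.2 (Finset.sum_nonneg fun i _ => hC0 i), fun t => ?_⟩
  refine (hqs (a t)).trans ?_
  rw [smul_apply, NNReal.smul_def, smul_eq_mul, mul_assoc]
  refine mul_le_mul_of_nonneg_left ?_ K.2
  have hS : 0 ≤ ∑ i ∈ s, C i := Finset.sum_nonneg fun i _ => hC0 i
  refine Seminorm.finset_sup_apply_le (by positivity) fun i hi => (hC i t).trans ?_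
  gcongr
  exact Finset.single_le_sum (f := C) (fun i _ => hC0 i) hi

variable [IsUniformAddGroup F]

theorem exists_ball_subset (hP : WithSeminorms P) {U : Set F} (hU : U ∈ 𝓝 (0 : F)) :
    ∃ q : Seminorm ℂ F, Continuous q ∧ ∃ ε > 0, ∀ x, q x < ε → x ∈ U := by
  obtain ⟨s, ε, hε, h⟩ := (hP.mem_nhds_iff 0 U).1 hU
  refine ⟨s.sup P, Seminorm.continuous_finsetSup fun i _ => hP.continuous_seminorm i, ε, hε,
    fun x hx => h ?_⟩
  simpa [Seminorm.mem_ball] using hx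

variable [CompleteSpace F]

/-- Cauchy's criterion in a complete space, tested one seminorm at a time. -/
theorem summable_of_seminorm (hP : WithSeminorms P) {f : ℕ → F}
    (h : ∀ q : Seminorm ℂ F, Continuous q → Summable fun t => q (f t)) : Summable f := by
  rw [summable_iff_vanishing]
  intro U hU
  obtain ⟨q, hq, ε, hε, hqU⟩ := exists_ball_subset hP hU
  obtain ⟨s, hs⟩ := summable_iff_vanishing_norm.1 (h q hq) ε hε
  refine ⟨s, fun t ht => hqU _ ((seminorm_sum_le q t f).trans_lt ?_)⟩
  exact (le_abs_self _).trans_lt (hs t ht)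

theorem RapidlyDecaying.summable (hP : WithSeminorms P) {a : ℕ → F} (ha : RapidlyDecaying a)
    {c : ℕ → ℂ} {s R : ℝ} (hR : 0 < R) (hc : ∀ t, ‖c t‖ ≤ s * R ^ t) :
    Summable fun t => c t • a t :=
  summable_of_seminorm hP fun q hq => ha.summable_seminorm q hq hR hc

theorem RapidlyDecaying.summable_pow_smul (hP : WithSeminorms P) {a : ℕ → F}
    (ha : RapidlyDecaying a) (z : ℂ) : Summable fun t => z ^ t • a t :=
  ha.summable hP (c := fun t => z ^ t) (s := 1) (R := 1 + ‖z‖) (by positivity) fun t => by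
    rw [norm_pow, one_mul]
    gcongr
    linarith

variable [T2Space F]

theorem RapidlyDecaying.tendstoLocallyUniformly (hP : WithSeminorms P) {a : ℕ → F}
    (ha : RapidlyDecaying a) :
    TendstoLocallyUniformly (fun (N : ℕ) (z : ℂ) => ∑ t ∈ Finset.range N, z ^ t • a t)
      (fun z => ∑' t, z ^ t • a t) atTop := by
  intro u hu z
  rw [uniformity_eq_comap_nhds_zero, mem_comap] at hu
  obtain ⟨W, hW, hWu⟩ := hu
  obtain ⟨q, hq, ε, hε, hqW⟩ := exists_ball_subset hP hW
  -- The value 1 + ‖z‖ bounds |w| on the whole unit ball around z, so one majorant controls all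
  -- tails there.
  obtain ⟨g, hg, hg0, h⟩ := ha.exists_norm_mul_le hq (R := 1 + ‖z‖) (by positivity)
  refine ⟨Metric.ball z 1, Metric.ball_mem_nhds z one_pos, ?_⟩
  filter_upwards [(tendsto_sum_nat_add g).eventually_lt_const hε] with N hN w hw
  refine hWu (hqW _ ?_)
  have hs := (ha.summable_pow_smul hP w)
  have h1 : ∑ t ∈ Finset.range N, w ^ t • a t - ∑' t, w ^ t • a t =
      -∑' t, w ^ (t + N) • a (t + N) := by
    rw [← hs.sum_add_tsum_nat_add N]
    abel
  have hw' : ‖w‖ ≤ 1 + ‖z‖ := by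
    have h2 := norm_add_le (w - z) z
    rw [sub_add_cancel] at h2
    have h3 : ‖w - z‖ < 1 := by simpa [dist_eq_norm] using hw
    linarith
  change q (∑ t ∈ Finset.range N, w ^ t • a t - ∑' t, w ^ t • a t) < ε
  rw [h1, map_neg_eq_map]
  refine lt_of_le_of_lt (seminorm_tsum_le hq ((summable_nat_add_iff N).2 hs)
    ((summable_nat_add_iff N).2 hg) fun t => ?_) hN
  have h4 := h (t + N) (w ^ (t + N)) 1 (by rw [norm_pow, one_mul]; gcongr)
  simpa using h4

/-- The left side consists of terms of the binomial expansion of (1 + A)^t. This bounds the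
coefficients t z^(t−1) of the derivative by a geometric sequence. -/
theorem pow_add_mul_pow_pred_le {A : ℝ} (hA : 0 ≤ A) (t : ℕ) :
    A ^ t + t * A ^ (t - 1) ≤ (1 + A) ^ t := by
  induction t with
  | zero => simp
  | succ t ih =>
    have h : A * (t * A ^ (t - 1)) = t * A ^ t := by
      cases t with
      | zero => simp
      | succ t => simp only [Nat.add_sub_cancel]; ring
    have h2 : 0 ≤ t * A ^ (t - 1) := by positivity
    rw [pow_succ (1 + A), Nat.add_sub_cancel]
    push_cast
    nlinarith [mul_le_mul_of_nonneg_right ih (show 0 ≤ 1 + A by positivity), pow_succ A t]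

/-- The Taylor remainders satisfy R_{t+1} = (z+h) R_t + h² t z^(t−1). Since |z+h| ≤ 1 + ‖z‖ and t
‖z‖^(t−1) ≤ (2 + ‖z‖)^t, each step costs at most a factor (1 + ‖z‖) + 1. -/
theorem norm_add_pow_sub_le {z h : ℂ} (hh : ‖h‖ ≤ 1) (t : ℕ) :
    ‖(z + h) ^ t - z ^ t - h * (t * z ^ (t - 1))‖ ≤ ‖h‖ ^ 2 * (2 + ‖z‖) ^ t := by
  induction t with
  | zero => simp
  | succ t ih =>
    have h1 : z * (t * z ^ (t - 1)) = t * z ^ t := by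
      cases t with
      | zero => simp
      | succ t => simp only [Nat.add_sub_cancel]; ring
    have h2 : (z + h) ^ (t + 1) - z ^ (t + 1) - h * ((t + 1 : ℕ) * z ^ (t + 1 - 1)) =
        (z + h) * ((z + h) ^ t - z ^ t - h * (t * z ^ (t - 1))) +
          h ^ 2 * (t * z ^ (t - 1)) := by
      rw [Nat.add_sub_cancel]
      push_cast
      linear_combination h * h1
    have h3 : ‖(t : ℂ) * z ^ (t - 1)‖ ≤ (2 + ‖z‖) ^ t := by
      rw [norm_mul, norm_pow, Complex.norm_natCast]
      have h4 := pow_add_mul_pow_pred_le (norm_nonneg z) t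
      have h5 : (1 + ‖z‖) ^ t ≤ (2 + ‖z‖) ^ t := by gcongr; norm_num
      have h6 : 0 ≤ ‖z‖ ^ t := by positivity
      linarith
    rw [h2]
    calc _ ≤ ‖z + h‖ * (‖h‖ ^ 2 * (2 + ‖z‖) ^ t) + ‖h‖ ^ 2 * (2 + ‖z‖) ^ t := by
          refine (norm_add_le _ _).trans (add_le_add ?_ ?_)
          · rw [norm_mul]
            gcongr
          · rw [norm_mul, norm_pow]
            gcongr
      _ ≤ (‖z‖ + 1) * (‖h‖ ^ 2 * (2 + ‖z‖) ^ t) + ‖h‖ ^ 2 * (2 + ‖z‖) ^ t := by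
          gcongr
          exact (norm_add_le _ _).trans (by linarith)
      _ = _ := by ring

/-- The derivative is the termwise one. In each seminorm of the family the remainder is at most K ‖w
− z‖² for ‖w − z‖ ≤ 1. -/
theorem RapidlyDecaying.differentiable [ContinuousSMul ℂ F] (hP : WithSeminorms P) {a : ℕ → F}
    (ha : RapidlyDecaying a) : Differentiable ℂ fun z : ℂ => ∑' t, z ^ t • a t := by
  intro z
  have hs' : Summable fun t : ℕ => ((t : ℂ) * z ^ (t - 1)) • a t :=
    ha.summable hP (c := fun t => (t : ℂ) * z ^ (t - 1)) (s := 1) (R := 1 + ‖z‖) (by positivity)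
      fun t => by
        rw [norm_mul, norm_pow, Complex.norm_natCast, one_mul]
        have h4 := pow_add_mul_pow_pred_le (norm_nonneg z) t
        have h6 : 0 ≤ ‖z‖ ^ t := by positivity
        linarith
  let D := ∑' t : ℕ, ((t : ℂ) * z ^ (t - 1)) • a t
  refine ⟨ContinuousLinearMap.toSpanSingleton ℂ D, ⟨?_⟩⟩
  rw [Asymptotics.isLittleOTVS_iff_tendsto_inv_smul
    (Eventually.of_forall fun p hp => by simp [sub_eq_zero.1 hp])]
  rw [hP.tendsto_nhds]
  intro i ε hε
  obtain ⟨g, hg, hg0, h⟩ := ha.exists_norm_mul_le (hP.continuous_seminorm i) (R := 2 + ‖z‖)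
    (by positivity)
  set K := ∑' t, g t
  have hK : 0 ≤ K := tsum_nonneg hg0
  rw [prod_pure, eventually_map]
  -- The bound 1 on the radius validates the remainder estimate; K + 1 replaces K to avoid dividing
  -- by zero.
  filter_upwards [Metric.ball_mem_nhds z (ε := min 1 (ε / (K + 1))) (by positivity)] with w hw
  have hw2 : ‖w - z‖ < min 1 (ε / (K + 1)) := by simpa [dist_eq_norm] using hw
  have hw1 : ‖w - z‖ ≤ 1 := (hw2.trans_le (min_le_left _ _)).le
  rw [sub_zero, map_smul_eq_mul, norm_inv]
  have h1 : ∑' t, w ^ t • a t - ∑' t, z ^ t • a t -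
      (ContinuousLinearMap.toSpanSingleton ℂ D) (w - z) =
      ∑' t : ℕ, ((z + (w - z)) ^ t - z ^ t - (w - z) * (t * z ^ (t - 1))) • a t := by
    rw [ContinuousLinearMap.toSpanSingleton_apply, ← hs'.tsum_const_smul,
      ← (ha.summable_pow_smul hP w).tsum_sub (ha.summable_pow_smul hP z),
      ← ((ha.summable_pow_smul hP w).sub (ha.summable_pow_smul hP z)).tsum_sub
        (hs'.const_smul _)]
    refine tsum_congr fun t => ?_
    rw [add_sub_cancel, smul_smul, sub_smul (w ^ t - z ^ t), sub_smul (w ^ t)]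
  have h2 : P i (∑' t, w ^ t • a t - ∑' t, z ^ t • a t -
      (ContinuousLinearMap.toSpanSingleton ℂ D) (w - z)) ≤ ‖w - z‖ ^ 2 * K := by
    rw [h1, ← tsum_mul_left]
    refine seminorm_tsum_le (hP.continuous_seminorm i) (ha.summable hP (R := 2 + ‖z‖)
      (by positivity) (norm_add_pow_sub_le hw1)) (hg.mul_left _) fun t => ?_
    exact h t _ _ (norm_add_pow_sub_le hw1 t)
  calc _ ≤ ‖w - z‖⁻¹ * (‖w - z‖ ^ 2 * K) := by gcongr
    _ = ‖w - z‖ * K := by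
        by_cases h0 : ‖w - z‖ = 0
        · simp [h0]
        · field_simp
    _ ≤ ‖w - z‖ * (K + 1) := by gcongr; linarith
    _ < ε := (lt_div_iff₀ (by positivity)).1 (hw2.trans_le (min_le_right _ _))

end Series

/-! ### Seminorms on the completion -/

section Completion

open UniformSpace Filter Topology

variable {E : Type*} [AddCommGroup E] [Module ℂ E] [UniformSpace E] [IsUniformAddGroup E]

theorem WithSeminorms.uniformContinuous {ι : Type*} {p : SeminormFamily ℂ E ι}
    (hp : WithSeminorms p) (i : ι) : UniformContinuous (p i) :=
  Seminorm.uniformContinuous_of_continuousAt_zero (hp.continuous_seminorm i).continuousAt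

variable [UniformContinuousConstSMul ℂ E]

/-- The extension of a continuous seminorm to the completion. -/
def seminormCompletion (q : Seminorm ℂ E) (hq : UniformContinuous q) :
    Seminorm ℂ (Completion E) :=
  Seminorm.of (Completion.extension q)
    (fun x y => by
      induction x, y using Completion.induction_on₂ with
      | hp =>
        exact isClosed_le (Completion.continuous_extension.comp continuous_add)
          ((Completion.continuous_extension.comp continuous_fst).add
            (Completion.continuous_extension.comp continuous_snd))
      | ih x y =>
        rw [← Completion.coe_add, Completion.extension_coe hq, Completion.extension_coe hq,
          Completion.extension_coe hq]
        exact map_add_le_add q x y)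
    (fun c x => by
      induction x using Completion.induction_on with
      | hp =>
        exact isClosed_eq (Completion.continuous_extension.comp (continuous_const_smul c))
          (continuous_const.mul Completion.continuous_extension)
      | ih x =>
        rw [← Completion.coe_smul, Completion.extension_coe hq, Completion.extension_coe hq]
        exact map_smul_eq_mul q c x)

theorem seminormCompletion_coe (q : Seminorm ℂ E) (hq : UniformContinuous q) (x : E) :
    seminormCompletion q hq x = q x :=
  Completion.extension_coe hq x

theorem continuous_seminormCompletion (q : Seminorm ℂ E) (hq : UniformContinuous q) :
    Continuous (seminormCompletion q hq) :=
  Completion.continuous_extension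

/-- Every neighbourhood of zero contains a closed one, and its trace on E contains a seminorm ball.
By density, a point of the corresponding open ball of the completion is a limit of points of that
ball in E, so it lies in the closed neighbourhood. -/
theorem withSeminorms_completion {ι : Type*} [Nonempty ι] {p : SeminormFamily ℂ E ι}
    (hp : WithSeminorms p) :
    WithSeminorms fun i => seminormCompletion (p i) (WithSeminorms.uniformContinuous hp i) := by
  set P : SeminormFamily ℂ (Completion E) ι :=
    fun i => seminormCompletion (p i) (WithSeminorms.uniformContinuous hp i) with hPdef
  have hP : ∀ s : Finset ι, Continuous (s.sup P : Seminorm ℂ (Completion E)) := fun s =>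
    Seminorm.continuous_finsetSup (p := P) fun i _ => continuous_seminormCompletion _ _
  have hsup : ∀ (s : Finset ι) (x : E), s.sup P x = s.sup p x := by
    intro s x
    rw [Seminorm.finset_sup_apply, Seminorm.finset_sup_apply]
    simp only [P, seminormCompletion_coe]
  refine SeminormFamily.withSeminorms_of_hasBasis P ⟨fun U => ⟨fun hU => ?_, ?_⟩⟩
  · obtain ⟨W, hW, hWc, hWU⟩ := exists_mem_nhds_isClosed_subset hU
    have h1 : ((↑) : E → Completion E) ⁻¹' W ∈ 𝓝 (0 : E) :=
      (Completion.continuous_coe E).continuousAt.preimage_mem_nhds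
        (by rwa [Completion.coe_zero])
    obtain ⟨s, r, hr, h2⟩ := (hp.mem_nhds_iff 0 _).1 h1
    refine ⟨(s.sup P).ball 0 r, P.basisSets_mem s hr, fun x hx => hWU ?_⟩
    have hO : IsOpen ((s.sup P).ball 0 r) := by
      rw [Seminorm.ball_zero_eq]
      exact isOpen_lt (hP s) continuous_const
    have h3 := Completion.denseRange_coe.open_subset_closure_inter hO hx
    refine hWc.closure_subset_iff.2 ?_ h3
    rintro _ ⟨hy, y, rfl⟩
    refine h2 ?_
    rw [Seminorm.mem_ball_zero] at hy ⊢
    rwa [hsup] at hy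
  · rintro ⟨B, hB, hBU⟩
    obtain ⟨s, r, hr, rfl⟩ := P.basisSets_iff.1 hB
    refine mem_of_superset ?_ hBU
    refine IsOpen.mem_nhds ?_ (by simpa using hr)
    simp only [id]
    rw [Seminorm.ball_zero_eq]
    exact isOpen_lt (hP s) continuous_const

end Completion

/-! ### The extended Laplace operator and its entire exponential -/

section Laplace

open UniformSpace Filter Topology

variable {V : Type*} [AddCommGroup V] [Module ℂ V]

theorem coe_laplaceSym_pow (b : LinearMap.BilinForm ℂ V) (t : ℕ) (X : SymTens V) :
    ((laplaceSym b ^ t) X : Tens V) = (laplace b ^ t) X := by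
  induction t with
  | zero => rfl
  | succ t ih =>
    rw [pow_succ', pow_succ', Module.End.mul_apply, Module.End.mul_apply, ← ih]
    rfl

variable [TopologicalSpace V]

theorem IsHilbertSchmidt.exists_series {b : LinearMap.BilinForm ℂ V} (hb : IsHilbertSchmidt b) :
    ∃ D : SymCpl V →L[ℂ] SymCpl V, (∀ X : SymTens V, D X = (laplaceSym b X : SymTens V)) ∧
      ∀ X : SymCpl V, ∃ F : ℂ → SymCpl V,
        (∀ q : Seminorm ℂ (SymCpl V), Continuous q →
          ∀ z : ℂ, Summable fun t : ℕ => q ((z ^ t / (t.factorial : ℂ)) • (D ^ t) X)) ∧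
        (∀ z : ℂ, HasSum (fun t : ℕ => (z ^ t / (t.factorial : ℂ)) • (D ^ t) X) (F z)) ∧
        TendstoLocallyUniformly
          (fun (N : ℕ) (z : ℂ) =>
            ∑ t ∈ Finset.range N, (z ^ t / (t.factorial : ℂ)) • (D ^ t) X) F atTop ∧
        Differentiable ℂ F := by
  obtain ⟨D, hD⟩ : ∃ D : SymCpl V →L[ℂ] SymCpl V,
      ∀ X : SymTens V, D X = (laplaceSym b X : SymTens V) := by
    let D₀ : SymTens V →L[ℂ] SymTens V := ⟨laplaceSym b, hb.continuous_laplaceSym⟩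
    refine ⟨D₀.completion, fun X => ?_⟩
    rw [ContinuousLinearMap.completion_apply_coe]
    rfl
  have hDpow : ∀ (t : ℕ) (X : SymTens V), (D ^ t) X = ((laplaceSym b ^ t) X : SymTens V) := by
    intro t X
    induction t with
    | zero => rfl
    | succ t ih =>
      rw [pow_succ', pow_succ', mul_apply_eq_comp, ih, hD, Module.End.mul_apply]
  have hP := withSeminorms_completion (withSeminorms_symTens (V := V))
  have hsmul : ContinuousSMul ℂ (SymCpl V) := hP.continuousSMul
  refine ⟨D, hD, fun X => ?_⟩
  let a : ℕ → SymCpl V := fun t => ((t.factorial : ℂ)⁻¹) • (D ^ t) X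
  have hca : ∀ (z : ℂ) (t : ℕ), (z ^ t / (t.factorial : ℂ)) • (D ^ t) X = z ^ t • a t :=
    fun z t => by rw [div_eq_mul_inv, mul_smul]
  have ha : RapidlyDecaying a := by
    refine WithSeminorms.rapidlyDecaying hP fun β r hr => ?_
    obtain ⟨γ, hγ⟩ := hb.exists_laplace_pow_le β hr
    have huc := WithSeminorms.uniformContinuous (withSeminorms_symTens (V := V))
    refine ⟨seminormCompletion (symSeminorms V γ) (huc γ) X, apply_nonneg _ _, fun t => ?_⟩
    have ht : (0 : ℝ) < t.factorial := by exact_mod_cast t.factorial_pos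
    rw [map_smul_eq_mul, norm_inv, Complex.norm_natCast, inv_mul_le_iff₀ ht]
    clear hca a
    -- For fixed t and γ the estimate is a closed condition on X, so it passes from symmetric
    -- tensors to the completion.
    induction X using Completion.induction_on with
    | hp =>
      exact isClosed_le ((continuous_seminormCompletion _ _).comp (D ^ t).continuous)
        (continuous_const.mul ((continuous_seminormCompletion _ _).mul continuous_const))
    | ih X =>
      rw [hDpow, seminormCompletion_coe, seminormCompletion_coe]
      have h1 := hγ t X
      rw [← coe_laplaceSym_pow] at h1
      refine h1.trans_eq ?_
      rw [mul_assoc, mul_comm (r ^ t)]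
      rfl
  refine ⟨fun z => ∑' t, z ^ t • a t, fun q hq z => ?_, fun z => ?_, ?_, ha.differentiable hP⟩
  · simp only [hca]
    exact ha.summable_seminorm q hq (c := fun t => z ^ t) (s := 1) (R := 1 + ‖z‖) (by positivity)
      fun t => by
        rw [norm_pow, one_mul]
        gcongr
        linarith
  · simp only [hca]
    exact (ha.summable_pow_smul hP z).hasSum
  · simp only [hca]
    exact ha.tendstoLocallyUniformly hP

end Laplace

/-! ### Exponentials of commuting locally nilpotent operators -/

section ExponentialLaws

variable {E F : Type*} [AddCommMonoid E] [Module ℂ E] [AddCommMonoid F] [Module ℂ F]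

theorem pow_apply_of_intertwine {D : E →ₗ[ℂ] E} {D' : F →ₗ[ℂ] F} {μ : E →ₗ[ℂ] F}
    (h : ∀ X, μ (D X) = D' (μ X)) (t : ℕ) (X : E) : μ ((D ^ t) X) = (D' ^ t) (μ X) := by
  induction t with
  | zero => rfl
  | succ t ih => rw [pow_succ', pow_succ', Module.End.mul_apply, Module.End.mul_apply, h, ih]

theorem LocallyNilpotent.apply_exp {D : E →ₗ[ℂ] E} {D' : F →ₗ[ℂ] F} (hD : LocallyNilpotent D)
    (hD' : LocallyNilpotent D') {μ : E →ₗ[ℂ] F} (h : ∀ X, μ (D X) = D' (μ X)) (X : E) :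
    μ (hD.exp X) = hD'.exp (μ X) := by
  obtain ⟨N, hN⟩ := hD X
  have hN' : (D' ^ N) (μ X) = 0 := by rw [← pow_apply_of_intertwine h, hN, map_zero]
  rw [hD.exp_apply_eq_sum hN, hD'.exp_apply_eq_sum hN', map_sum]
  simp only [map_smul, pow_apply_of_intertwine h]

theorem LocallyNilpotent.of_intertwine {D : E →ₗ[ℂ] E} {D' : F →ₗ[ℂ] F}
    (hD' : LocallyNilpotent D') {μ : E →ₗ[ℂ] F} (hμ : Function.Injective μ)
    (h : ∀ X, μ (D X) = D' (μ X)) : LocallyNilpotent D := by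
  intro X
  obtain ⟨N, hN⟩ := hD' (μ X)
  exact ⟨N, hμ (by rw [pow_apply_of_intertwine h, hN, map_zero])⟩

theorem pow_mul_pow_apply_eq_zero {A B : Module.End ℂ E} (hAB : Commute A B) {X : E} {N : ℕ}
    (hA : (A ^ N) X = 0) (hB : (B ^ N) X = 0) {i j : ℕ} (hij : N ≤ i ∨ N ≤ j) :
    (A ^ i * B ^ j) X = 0 := by
  rcases hij with hi | hj
  · rw [(hAB.pow_pow i j).eq, Module.End.mul_apply, pow_apply_eq_zero_of_le hA hi, map_zero]
  · rw [Module.End.mul_apply, pow_apply_eq_zero_of_le hB hj, map_zero]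

theorem exists_pow_apply_eq_zero {A B : Module.End ℂ E} (hA : LocallyNilpotent A)
    (hB : LocallyNilpotent B) (X : E) : ∃ N, (A ^ N) X = 0 ∧ (B ^ N) X = 0 := by
  obtain ⟨N, hN⟩ := hA X
  obtain ⟨M, hM⟩ := hB X
  exact ⟨max N M, pow_apply_eq_zero_of_le hN (le_max_left _ _),
    pow_apply_eq_zero_of_le hM (le_max_right _ _)⟩

/-- If i + j = 2N, one of the two exponents is at least N, so every binomial term kills X. -/
theorem add_pow_apply_eq_zero {A B : Module.End ℂ E} (hAB : Commute A B) {X : E} {N : ℕ}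
    (hA : (A ^ N) X = 0) (hB : (B ^ N) X = 0) : ((A + B) ^ (2 * N)) X = 0 := by
  rw [hAB.add_pow', LinearMap.sum_apply]
  refine Finset.sum_eq_zero fun p hp => ?_
  rw [Finset.HasAntidiagonal.mem_antidiagonal] at hp
  rw [LinearMap.smul_apply, pow_mul_pow_apply_eq_zero hAB hA hB (by omega), smul_zero]

theorem LocallyNilpotent.add {A B : Module.End ℂ E} (hA : LocallyNilpotent A)
    (hB : LocallyNilpotent B) (hAB : Commute A B) : LocallyNilpotent (A + B) := by
  intro X
  obtain ⟨N, hN, hM⟩ := exists_pow_apply_eq_zero hA hB X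
  exact ⟨2 * N, add_pow_apply_eq_zero hAB hN hM⟩

/-- The double series is supported in the square of exponents below N and is resummed along the
diagonals i + j = n. The sum is passed as a separate `C` so that any bracketing of it can be used.
-/
theorem LocallyNilpotent.exp_add {A B C : Module.End ℂ E} (hA : LocallyNilpotent A)
    (hB : LocallyNilpotent B) (hC : LocallyNilpotent C) (hAB : Commute A B) (h : C = A + B)
    (X : E) : hC.exp X = hA.exp (hB.exp X) := by
  subst h
  obtain ⟨N, hN, hM⟩ := exists_pow_apply_eq_zero hA hB X
  let f : ℕ × ℕ → E := fun p =>
    ((p.1.factorial : ℂ)⁻¹ * (p.2.factorial : ℂ)⁻¹) • (A ^ p.1 * B ^ p.2) X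
  have hf : ∀ p, N ≤ p.1 ∨ N ≤ p.2 → f p = 0 := fun p hp => by
    simp only [f, pow_mul_pow_apply_eq_zero hAB hN hM hp, smul_zero]
  have h1 : hA.exp (hB.exp X) = ∑ p ∈ Finset.range N ×ˢ Finset.range N, f p := by
    rw [hB.exp_apply_eq_sum hM, map_sum, Finset.sum_product_right]
    refine Finset.sum_congr rfl fun j _ => ?_
    have h2 : (A ^ N) ((B ^ j) X) = 0 := by
      rw [← Module.End.mul_apply]
      exact pow_mul_pow_apply_eq_zero hAB hN hM (Or.inl le_rfl)
    rw [map_smul, hA.exp_apply_eq_sum h2, Finset.smul_sum]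
    refine Finset.sum_congr rfl fun i _ => ?_
    simp only [f, smul_smul, Module.End.mul_apply, mul_comm]
  rw [h1, hC.exp_apply_eq_sum (add_pow_apply_eq_zero hAB hN hM),
    ← Finset.sum_fiberwise_of_maps_to (g := fun p : ℕ × ℕ => p.1 + p.2)
      (t := Finset.range (2 * N)) (fun p hp => by
        simp only [Finset.mem_product, Finset.mem_range] at hp ⊢
        omega)]
  refine Finset.sum_congr rfl fun n _ => ?_
  rw [Finset.sum_subset (s₂ := Finset.HasAntidiagonal.antidiagonal n)
    (fun p hp => Finset.HasAntidiagonal.mem_antidiagonal.2 (Finset.mem_filter.1 hp).2)]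
  · rw [hAB.add_pow', LinearMap.sum_apply, Finset.smul_sum]
    refine Finset.sum_congr rfl fun p hp => ?_
    rw [Finset.HasAntidiagonal.mem_antidiagonal] at hp
    subst hp
    rw [LinearMap.smul_apply, ← Nat.cast_smul_eq_nsmul ℂ, smul_smul]
    simp only [f]
    congr 1
    have h2 := Nat.add_choose_mul_factorial_mul_factorial p.2 p.1
    rw [add_comm p.2 p.1] at h2
    have h3 := Nat.cast_ne_zero (R := ℂ).2 (p.1 + p.2).factorial_ne_zero
    have h4 := Nat.cast_ne_zero (R := ℂ).2 p.1.factorial_ne_zero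
    have h5 := Nat.cast_ne_zero (R := ℂ).2 p.2.factorial_ne_zero
    field_simp
    rw [← h2]
    push_cast
    ring
  -- Pairs on the diagonal but outside the square contribute zero.
  · intro p hp hp'
    refine hf p ?_
    by_contra! hlt
    refine hp' ?_
    simp only [Finset.mem_filter, Finset.mem_product, Finset.mem_range]
    exact ⟨hlt, Finset.HasAntidiagonal.mem_antidiagonal.1 hp⟩

theorem LocallyNilpotent.exp_exp_neg {E : Type*} [AddCommGroup E] [Module ℂ E]
    {A B : Module.End ℂ E} (hA : LocallyNilpotent A)
    (hB : LocallyNilpotent B) (h : B = -A) (X : E) : hA.exp (hB.exp X) = X := by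
  have h0 : LocallyNilpotent (0 : Module.End ℂ E) := fun X => ⟨1, by simp⟩
  rw [← hA.exp_add hB h0 (h ▸ (Commute.refl A).neg_right) (by rw [h, add_neg_cancel]),
    h0.exp_apply_eq_sum (N := 1) (by simp)]
  simp

end ExponentialLaws

/-! ### Polarization and comparison of coefficients -/

section Polarization

variable {E M : Type*} [AddCommGroup E] [Module ℂ E] [AddCommGroup M] [Module ℂ M]

/-- Inclusion–exclusion: after multilinear expansion over all maps r of the index set, the signs
cancel every r that misses an index, and the surjective r are the permutations. -/
theorem MultilinearMap.sum_neg_one_pow_smul_eq_sum_perm {k : ℕ}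
    (f : MultilinearMap ℂ (fun _ : Fin k => E) M) (x : Fin k → E) :
    ∑ T : Finset (Fin k), ((-1 : ℂ) ^ Tᶜ.card) • f (fun _ => ∑ i ∈ T, x i) =
      ∑ σ : Equiv.Perm (Fin k), f fun i => x (σ i) := by
  classical
  have h1 : ∀ r : Fin k → Fin k, ∑ T : Finset (Fin k),
      (if ∀ j, r j ∈ T then (-1 : ℂ) ^ Tᶜ.card else 0) =
        if Function.Bijective r then 1 else 0 := by
    intro r
    -- The signed count of the sets T containing the range of r is ∏ (1 + εᵢ), with εᵢ = 0 on the
    -- range and −1 off it. A missed index produces a zero factor.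
    have h2 := Finset.prod_add (fun _ => (1 : ℂ))
      (fun i : Fin k => if ∃ j, r j = i then 0 else -1) Finset.univ
    simp only [Finset.prod_const_one, one_mul, Finset.powerset_univ] at h2
    have h3 : ∀ T : Finset (Fin k), (if ∀ j, r j ∈ T then (-1 : ℂ) ^ Tᶜ.card else 0) =
        ∏ i ∈ Finset.univ \ T, if ∃ j, r j = i then (0 : ℂ) else -1 := by
      intro T
      split_ifs with hT
      · rw [← Finset.compl_eq_univ_sdiff, ← Finset.prod_const]
        refine Finset.prod_congr rfl fun i hi => ?_
        rw [if_neg]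
        rintro ⟨j, rfl⟩
        exact Finset.mem_compl.1 hi (hT j)
      · push Not at hT
        obtain ⟨j, hj⟩ := hT
        have hj' : r j ∈ Finset.univ \ T := by simpa using hj
        exact (Finset.prod_eq_zero hj' (by rw [if_pos ⟨j, rfl⟩])).symm
    rw [Finset.sum_congr rfl fun T _ => h3 T, ← h2]
    split_ifs with hr
    · refine Finset.prod_eq_one fun i _ => ?_
      rw [if_pos (hr.surjective i), add_zero]
    · have hr2 : ¬ Function.Surjective r := fun h => hr (Finite.surjective_iff_bijective.1 h)
      simp only [Function.Surjective, not_forall] at hr2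
      obtain ⟨i, hi⟩ := hr2
      refine Finset.prod_eq_zero (Finset.mem_univ i) ?_
      rw [if_neg hi, add_neg_cancel]
  calc _ = ∑ T : Finset (Fin k), ∑ r : Fin k → Fin k,
        (if ∀ j, r j ∈ T then (-1 : ℂ) ^ Tᶜ.card else 0) • f fun i => x (r i) := by
        refine Finset.sum_congr rfl fun T _ => ?_
        rw [f.map_sum_finset (fun _ i => x i) (fun _ => T), Finset.smul_sum]
        have h4 : Fintype.piFinset (fun _ : Fin k => T) =
            Finset.univ.filter fun r : Fin k → Fin k => ∀ j, r j ∈ T := by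
          ext r
          simp
        rw [h4, Finset.sum_filter]
        refine Finset.sum_congr rfl fun r _ => ?_
        split_ifs <;> simp
    _ = ∑ r : Fin k → Fin k, if Function.Bijective r then f (fun i => x (r i)) else 0 := by
        rw [Finset.sum_comm]
        refine Finset.sum_congr rfl fun r _ => ?_
        rw [← Finset.sum_smul, h1]
        split_ifs <;> simp
    _ = _ := by
        rw [← Finset.sum_filter]
        refine Finset.sum_bij (fun r hr => Equiv.ofBijective r (Finset.mem_filter.1 hr).2)
          (fun _ _ => Finset.mem_univ _) (fun r _ r' _ h => ?_) (fun σ _ => ?_) fun r _ => ?_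
        · exact congrArg DFunLike.coe h
        · exact ⟨σ, Finset.mem_filter.2 ⟨Finset.mem_univ _, σ.bijective⟩, Equiv.ext fun _ => rfl⟩
        · rfl

/-- A polynomial with coefficients in a vector space that vanishes everywhere is zero. -/
theorem eq_zero_of_forall_sum_pow_smul_eq_zero {n : ℕ} {a : ℕ → M}
    (h : ∀ s : ℂ, ∑ k ∈ Finset.range n, s ^ k • a k = 0) {k : ℕ} (hk : k < n) : a k = 0 := by
  -- Linear functionals separate points, which reduces the claim to scalar polynomials.
  rw [← Module.forall_dual_apply_eq_zero_iff ℂ]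
  intro φ
  have hp : (∑ k ∈ Finset.range n, Polynomial.monomial k (φ (a k)) : Polynomial ℂ) = 0 := by
    refine Polynomial.funext fun s => ?_
    have h1 := congrArg φ (h s)
    simp only [map_sum, map_smul, smul_eq_mul, map_zero] at h1
    rw [Polynomial.eval_finsetSum, Polynomial.eval_zero, ← h1]
    exact Finset.sum_congr rfl fun k _ => by rw [Polynomial.eval_monomial, mul_comm]
  have h2 := congrArg (fun p => Polynomial.coeff p k) hp
  simpa [Polynomial.finsetSum_coeff, Polynomial.coeff_monomial, hk] using h2

end Polarization

/-! ### Divided powers and the Leibniz rule -/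

section DividedPowers

variable {V : Type*} [AddCommGroup V] [Module ℂ V]

/-- The divided power `v^{⊗n} / n!` in the tensor algebra, which is zero for negative `n`. -/
def divPow : ℤ → V → Tens V
  | Int.ofNat n, v => ((n.factorial : ℂ)⁻¹) • incl n (PiTensorProduct.tprod ℂ fun _ => v)
  | Int.negSucc _, _ => 0

theorem divPow_natCast (n : ℕ) (v : V) :
    divPow n v = ((n.factorial : ℂ)⁻¹) • incl n (PiTensorProduct.tprod ℂ fun _ => v) := rfl

theorem divPow_of_neg {n : ℤ} (hn : n < 0) (v : V) : divPow n v = 0 := by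
  obtain ⟨m, rfl⟩ := Int.eq_negSucc_of_lt_zero hn
  rfl

theorem symPow_tprod_const (n : ℕ) (v : V) :
    symPow n (PiTensorProduct.tprod ℂ fun _ : Fin n => v) = PiTensorProduct.tprod ℂ fun _ => v :=
  symPow_eq_self fun τ => permute_tprod τ _

theorem symmetrizer_incl (n : ℕ) (x : ⨂[ℂ]^n V) :
    symmetrizer V (incl n x) = incl n (symPow n x) := by
  rw [symmetrizer, DirectSum.toModule_lof]
  rfl

/-- Polarization writes a symmetrised pure tensor as a combination of powers of the partial sums
∑_{i ∈ T} yᵢ. -/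
theorem symTens_le_span_divPow :
    SymTens V ≤ Submodule.span ℂ (Set.range fun p : ℤ × V => divPow p.1 p.2) := by
  rintro _ ⟨X, rfl⟩
  induction X using DirectSum.induction_on with
  | zero => simp
  | add X Y hX hY => simpa only [map_add] using Submodule.add_mem _ hX hY
  | of k x =>
    rw [← DirectSum.lof_eq_of ℂ, symmetrizer_incl]
    have hx : x ∈ Submodule.span ℂ
        (Set.range (PiTensorProduct.tprod ℂ (s := fun _ : Fin k => V))) := by
      rw [PiTensorProduct.span_tprod_eq_top]
      trivial
    induction hx using Submodule.span_induction with
    | zero => simp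
    | add x y _ _ hx hy => simpa only [map_add] using Submodule.add_mem _ hx hy
    | smul c x _ hx => simpa only [map_smul] using Submodule.smul_mem _ c hx
    | mem x hx =>
      obtain ⟨y, rfl⟩ := hx
      simp only [symPow, LinearMap.smul_apply, LinearMap.sum_apply, permute_tprod]
      rw [← MultilinearMap.sum_neg_one_pow_smul_eq_sum_perm, map_smul, map_sum]
      refine Submodule.smul_mem _ _ (Submodule.sum_mem _ fun T _ => ?_)
      rw [map_smul]
      refine Submodule.smul_mem _ _ ?_
      have h : incl k (PiTensorProduct.tprod ℂ fun _ : Fin k => ∑ i ∈ T, y i) =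
          (k.factorial : ℂ) • divPow k (∑ i ∈ T, y i) := by
        rw [divPow_natCast, smul_smul, mul_inv_cancel₀ (Nat.cast_ne_zero.2 k.factorial_ne_zero),
          one_smul]
      rw [h]
      exact Submodule.smul_mem _ _ (Submodule.subset_span ⟨(k, ∑ i ∈ T, y i), rfl⟩)

/-- The normalisation 1/n! absorbs n(n−1). With integer exponents and zero in negative degree, one
formula also covers the low degrees, where Δ_b vanishes. -/
theorem laplace_divPow (b : LinearMap.BilinForm ℂ V) (n : ℤ) (v : V) :
    laplace b (divPow n v) = (b v v / 2) • divPow (n - 2) v := by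
  rcases lt_or_ge n 0 with hn | hn
  · rw [divPow_of_neg hn, divPow_of_neg (by omega), map_zero, smul_zero]
  lift n to ℕ using hn
  match n with
  | 0 =>
    rw [divPow_natCast, divPow_of_neg (n := ((0 : ℕ) : ℤ) - 2) (by omega), map_smul, laplace,
      DirectSum.toModule_lof]
    simp [laplaceDeg]
  | 1 =>
    rw [divPow_natCast, divPow_of_neg (n := ((1 : ℕ) : ℤ) - 2) (by omega), map_smul, laplace,
      DirectSum.toModule_lof]
    simp [laplaceDeg]
  | n + 2 =>
    have h : ((n + 2 : ℕ) : ℤ) - 2 = (n : ℤ) := by simp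
    rw [h, divPow_natCast, divPow_natCast]
    simp only [map_smul, laplace, DirectSum.toModule_lof, laplaceDeg, smul_smul,
      LinearMap.smul_apply, LinearMap.comp_apply, contractFirst_tprod]
    congr 1
    have h3 := Nat.cast_ne_zero (R := ℂ).2 n.factorial_ne_zero
    have h4 : (n + 1 : ℂ) ≠ 0 := by exact_mod_cast n.succ_ne_zero
    have h5 : (n + 2 : ℂ) ≠ 0 := by exact_mod_cast (n + 1).succ_ne_zero
    rw [Nat.factorial_succ, Nat.factorial_succ]
    push_cast
    rw [add_assoc (n : ℂ), one_add_one_eq_two]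
    field_simp

theorem poisson_divPow (Λ : LinearMap.BilinForm ℂ V) (k l : ℤ) (v w : V) :
    poisson Λ (divPow k v ⊗ₜ divPow l w) =
      Λ v w • (divPow (k - 1) v ⊗ₜ[ℂ] divPow (l - 1) w) := by
  rcases lt_or_ge k 0 with hk | hk
  · rw [divPow_of_neg hk, divPow_of_neg (n := k - 1) (by omega)]
    simp
  rcases lt_or_ge l 0 with hl | hl
  · rw [divPow_of_neg hl, divPow_of_neg (n := l - 1) (by omega)]
    simp
  lift k to ℕ using hk
  lift l to ℕ using hl
  have h : poisson Λ (divPow k v ⊗ₜ divPow l w) =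
      ((k.factorial : ℂ)⁻¹ * (l.factorial : ℂ)⁻¹) • poissonDeg Λ k l
        (PiTensorProduct.tprod ℂ (fun _ => v) ⊗ₜ PiTensorProduct.tprod ℂ fun _ => w) := by
    rw [← poisson_map, divPow_natCast, divPow_natCast, TensorProduct.map_tmul,
      TensorProduct.smul_tmul_smul, map_smul]
  rw [h]
  match k, l with
  | 0, l =>
    rw [divPow_of_neg (n := ((0 : ℕ) : ℤ) - 1) (by omega)]
    simp [poissonDeg]
  | k + 1, 0 =>
    rw [divPow_of_neg (n := ((0 : ℕ) : ℤ) - 1) (by omega)]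
    simp [poissonDeg]
  | k + 1, l + 1 =>
    have hk : ((k + 1 : ℕ) : ℤ) - 1 = (k : ℤ) := by simp
    have hl : ((l + 1 : ℕ) : ℤ) - 1 = (l : ℤ) := by simp
    rw [hk, hl, divPow_natCast, divPow_natCast, TensorProduct.smul_tmul_smul]
    simp only [poissonDeg, LinearMap.smul_apply, LinearMap.comp_apply, TensorProduct.map_tmul,
      splitLast_tprod, splitFirst_tprod, pairing, LinearEquiv.coe_coe,
      TensorProduct.tensorTensorTensorComm_tmul, TensorProduct.lift.tmul, LinearMap.id_apply,
      TensorProduct.rid_tmul, map_smul, smul_smul]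
    congr 1
    have h3 := Nat.cast_ne_zero (R := ℂ).2 k.factorial_ne_zero
    have h4 := Nat.cast_ne_zero (R := ℂ).2 l.factorial_ne_zero
    have h5 : (k + 1 : ℂ) ≠ 0 := by exact_mod_cast k.succ_ne_zero
    have h6 : (l + 1 : ℂ) ≠ 0 := by exact_mod_cast l.succ_ne_zero
    rw [Nat.factorial_succ, Nat.factorial_succ]
    push_cast
    field_simp

/-- The symmetric product of two divided powers. -/
def veePow (k l : ℤ) (v w : V) : Tens V := (mulVee (divPow k v ⊗ₜ divPow l w) : SymTens V)

theorem veePow_of_neg_left {k : ℤ} (hk : k < 0) (l : ℤ) (v w : V) : veePow k l v w = 0 := by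
  simp [veePow, divPow_of_neg hk]

theorem veePow_of_neg_right (k : ℤ) {l : ℤ} (hl : l < 0) (v w : V) : veePow k l v w = 0 := by
  simp [veePow, divPow_of_neg hl]

theorem veePow_natCast (k l : ℕ) (v w : V) :
    veePow k l v w = ((k.factorial : ℂ)⁻¹ * (l.factorial : ℂ)⁻¹) • incl (k + l)
      (symPow (k + l) (PiTensorProduct.tprod ℂ fun i : Fin (k + l) =>
        if (i : ℕ) < k then v else w)) := by
  rw [veePow, divPow_natCast, divPow_natCast, TensorProduct.smul_tmul_smul, map_smul,
    Submodule.coe_smul]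
  congr 1
  change symmetrizer V (LinearMap.mul' ℂ (Tens V) _) = _
  rw [LinearMap.mul'_apply, DirectSum.lof_eq_of, DirectSum.lof_eq_of, DirectSum.of_mul_of,
    TensorPower.tprod_mul_tprod, ← DirectSum.lof_eq_of ℂ, symmetrizer_incl]
  congr 4
  funext i
  refine Fin.addCases (fun i => ?_) (fun i => ?_) i
  · simp
  · simp

theorem symPow_permute {k : ℕ} (τ : Equiv.Perm (Fin k)) (x : ⨂[ℂ]^k V) :
    symPow k (permute τ x) = symPow k x := by
  have h : symPow k ∘ₗ permute τ = symPow (V := V) k := by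
    ext x
    simp only [LinearMap.compMultilinearMap_apply, LinearMap.comp_apply, symPow,
      LinearMap.smul_apply, LinearMap.sum_apply, permute_tprod]
    congr 1
    exact Fintype.sum_equiv (Equiv.mulLeft τ) _ _ fun σ => rfl
  exact LinearMap.congr_fun h x

/-- After symmetrisation only the number of slots holding v matters: a bijection from T onto the
first |T| positions extends to a permutation. -/
theorem symPow_tprod_piecewise {n : ℕ} (T : Finset (Fin n)) (v w : V) :
    symPow n (PiTensorProduct.tprod ℂ fun i => if i ∈ T then v else w) =
      symPow n (PiTensorProduct.tprod ℂ fun i : Fin n => if (i : ℕ) < T.card then v else w) := by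
  classical
  have hc : Fintype.card {i // i ∈ T} = Fintype.card {i : Fin n // (i : ℕ) < T.card} := by
    rw [Fintype.card_coe, Fintype.card_subtype]
    have hle : T.card ≤ n := by simpa using T.card_le_univ
    rw [Fin.card_filter_val_lt, min_eq_right hle]
  let e : {i // i ∈ T} ≃ {i : Fin n // (i : ℕ) < T.card} := Fintype.equivOfCardEq hc
  rw [← symPow_permute e.extendSubtype (PiTensorProduct.tprod ℂ fun i : Fin n =>
    if (i : ℕ) < T.card then v else w), permute_tprod]
  congr 2
  funext i
  by_cases hi : i ∈ T
  · rw [if_pos hi, if_pos (e.extendSubtype_mem i hi)]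
  · rw [if_neg hi, if_neg (e.extendSubtype_not_mem i hi)]

/-- The binomial theorem for divided powers. -/
theorem divPow_smul_add (n : ℕ) (s : ℂ) (v w : V) :
    divPow n (s • v + w) = ∑ k ∈ Finset.range (n + 1), s ^ k • veePow k (n - k) v w := by
  classical
  let W : ℕ → ⨂[ℂ]^n V := fun m =>
    symPow n (PiTensorProduct.tprod ℂ fun i : Fin n => if (i : ℕ) < m then v else w)
  have h1 : (PiTensorProduct.tprod ℂ fun _ : Fin n => s • v + w) =
      ∑ k ∈ Finset.range (n + 1), n.choose k • s ^ k • W k := by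
    rw [← symPow_tprod_const]
    have h2 := (PiTensorProduct.tprod ℂ (s := fun _ : Fin n => V)).map_add_univ
      (fun _ => s • v) fun _ => w
    have h3 : ∀ T : Finset (Fin n), (PiTensorProduct.tprod ℂ (s := fun _ : Fin n => V))
        (T.piecewise (fun _ => s • v) fun _ => w) =
        s ^ T.card • PiTensorProduct.tprod ℂ fun i => if i ∈ T then v else w := by
      intro T
      have h4 := (PiTensorProduct.tprod ℂ (s := fun _ : Fin n => V)).map_piecewise_smul
        (fun _ => s) (fun i => if i ∈ T then v else w) T
      rw [Finset.prod_const] at h4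
      rw [← h4]
      congr 1
      funext i
      by_cases hi : i ∈ T <;> simp [hi]
    change symPow n (PiTensorProduct.tprod ℂ ((fun _ => s • v) + fun _ => w)) = _
    rw [h2, map_sum]
    simp only [h3, map_smul, symPow_tprod_piecewise]
    rw [← Finset.powerset_univ]
    rw [Finset.sum_powerset_apply_card fun m => s ^ m • W m]
    simp
  rw [divPow_natCast, h1, map_sum, Finset.smul_sum]
  refine Finset.sum_congr rfl fun k hk => ?_
  obtain ⟨l, rfl⟩ := Nat.exists_eq_add_of_le (Nat.lt_succ_iff.1 (Finset.mem_range.1 hk))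
  have h5 : ((k + l : ℕ) : ℤ) - k = (l : ℤ) := by simp
  rw [h5, veePow_natCast, ← Nat.cast_smul_eq_nsmul ℂ, map_smul, map_smul, smul_smul, smul_smul,
    smul_smul]
  congr 1
  have h6 := Nat.add_choose_mul_factorial_mul_factorial l k
  rw [add_comm l k] at h6
  have h7 := Nat.cast_ne_zero (R := ℂ).2 (k + l).factorial_ne_zero
  have h8 := Nat.cast_ne_zero (R := ℂ).2 k.factorial_ne_zero
  have h9 := Nat.cast_ne_zero (R := ℂ).2 l.factorial_ne_zero
  field_simp
  rw [← h6]
  push_cast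
  ring

/-- This and the two identities below are the binomial theorem in degree n − 2, reindexed for the
three terms of the Leibniz rule; the boundary terms have a negative exponent and vanish. -/
theorem sum_veePow_sub_two_left (n : ℕ) (s : ℂ) (v w : V) :
    ∑ j ∈ Finset.range (n + 1), s ^ j • veePow (j - 2) (n - j) v w =
      s ^ 2 • divPow (n - 2) (s • v + w) := by
  obtain _ | _ | n := n
  · rw [divPow_of_neg (by simp)]
    simp [veePow_of_neg_left]
  · rw [divPow_of_neg (by simp)]
    simp [veePow_of_neg_left, Finset.sum_range_succ]
  · have h3 : ((n + 1 + 1 : ℕ) : ℤ) - 2 = (n : ℤ) := by push_cast; ring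
    rw [Finset.sum_range_succ', Finset.sum_range_succ', veePow_of_neg_left (by simp),
      veePow_of_neg_left (by simp), smul_zero, smul_zero, add_zero, add_zero, h3,
      divPow_smul_add, Finset.smul_sum]
    refine Finset.sum_congr rfl fun j _ => ?_
    rw [smul_smul, ← pow_add]
    congr 1
    · ring
    · congr 1 <;> push_cast <;> ring

theorem sum_veePow_sub_two_right (n : ℕ) (s : ℂ) (v w : V) :
    ∑ j ∈ Finset.range (n + 1), s ^ j • veePow j (n - j - 2) v w =
      divPow (n - 2) (s • v + w) := by
  obtain _ | _ | n := n
  · rw [divPow_of_neg (by simp)]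
    simp [veePow_of_neg_right]
  · rw [divPow_of_neg (by simp)]
    simp [veePow_of_neg_right]
  · have h3 : ((n + 1 + 1 : ℕ) : ℤ) - 2 = (n : ℤ) := by push_cast; ring
    rw [Finset.sum_range_succ, Finset.sum_range_succ, veePow_of_neg_right _ (by push_cast; omega),
      veePow_of_neg_right _ (by push_cast; omega), smul_zero, smul_zero, add_zero, add_zero, h3,
      divPow_smul_add]
    refine Finset.sum_congr rfl fun j _ => ?_
    congr 2
    push_cast
    ring

theorem sum_veePow_sub_one (n : ℕ) (s : ℂ) (v w : V) :
    ∑ j ∈ Finset.range (n + 1), s ^ j • veePow (j - 1) (n - j - 1) v w =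
      s • divPow (n - 2) (s • v + w) := by
  obtain _ | _ | n := n
  · rw [divPow_of_neg (by simp)]
    simp [veePow_of_neg_left]
  · rw [divPow_of_neg (by simp)]
    simp [veePow_of_neg_left, veePow_of_neg_right, Finset.sum_range_succ]
  · have h3 : ((n + 1 + 1 : ℕ) : ℤ) - 2 = (n : ℤ) := by push_cast; ring
    rw [Finset.sum_range_succ', Finset.sum_range_succ,
      veePow_of_neg_left (k := ((0 : ℕ) : ℤ) - 1) (by simp),
      veePow_of_neg_right _ (by push_cast; omega), smul_zero, smul_zero, add_zero, add_zero, h3,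
      divPow_smul_add, Finset.smul_sum]
    refine Finset.sum_congr rfl fun j _ => ?_
    rw [smul_smul, ← pow_succ']
    congr 1
    congr 1 <;> push_cast <;> ring

/-- The Leibniz rule with its mixed term. It need not be computed slot by slot: apply Δ_b to the
divided power of s v + w, expand b(sv+w, sv+w), and compare coefficients of powers of s. -/
theorem laplace_veePow (b : LinearMap.BilinForm ℂ V) (hb : ∀ v w, b v w = b w v) (k l : ℤ)
    (v w : V) : laplace b (veePow k l v w) =
      (b v v / 2) • veePow (k - 2) l v w + (b w w / 2) • veePow k (l - 2) v w +
        b v w • veePow (k - 1) (l - 1) v w := by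
  rcases lt_or_ge k 0 with hk | hk
  · simp [veePow_of_neg_left hk, veePow_of_neg_left (show k - 2 < 0 by omega),
      veePow_of_neg_left (show k - 1 < 0 by omega)]
  rcases lt_or_ge l 0 with hl | hl
  · simp [veePow_of_neg_right _ hl, veePow_of_neg_right _ (show l - 2 < 0 by omega),
      veePow_of_neg_right _ (show l - 1 < 0 by omega)]
  lift k to ℕ using hk
  lift l to ℕ using hl
  -- The defect of the Leibniz rule in bidegree (j, n − j). It is the s^j coefficient of a
  -- polynomial that vanishes for all s.
  let a : ℕ → ℕ → Tens V := fun n j => laplace b (veePow j (n - j) v w) -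
    ((b v v / 2) • veePow (j - 2) (n - j) v w +
      (b w w / 2) • veePow j (n - j - 2) v w +
        b v w • veePow (j - 1) (n - j - 1) v w)
  have ha : ∀ (n : ℕ) (s : ℂ), ∑ j ∈ Finset.range (n + 1), s ^ j • a n j = 0 := by
    intro n s
    have h1 := congrArg (laplace b) (divPow_smul_add n s v w)
    rw [laplace_divPow, map_sum] at h1
    have h2 : ∑ j ∈ Finset.range (n + 1), s ^ j • a n j =
        ∑ j ∈ Finset.range (n + 1), laplace b (s ^ j • veePow j (n - j) v w) -
        ((b v v / 2) • ∑ j ∈ Finset.range (n + 1), s ^ j • veePow (j - 2) (n - j) v w +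
        (b w w / 2) • ∑ j ∈ Finset.range (n + 1), s ^ j • veePow j (n - j - 2) v w +
        b v w • ∑ j ∈ Finset.range (n + 1), s ^ j • veePow (j - 1) (n - j - 1) v w) := by
      simp only [a, Finset.smul_sum, ← Finset.sum_add_distrib, ← Finset.sum_sub_distrib]
      refine Finset.sum_congr rfl fun j _ => ?_
      simp only [smul_sub, smul_add, map_smul, smul_comm (s ^ j)]
    rw [h2, ← h1, sub_eq_zero]
    rw [sum_veePow_sub_two_left, sum_veePow_sub_two_right, sum_veePow_sub_one, smul_smul,
      smul_smul, ← add_smul, ← add_smul]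
    congr 1
    simp only [map_add, map_smul, LinearMap.add_apply, LinearMap.smul_apply, smul_eq_mul, hb w v]
    ring
  have h := eq_zero_of_forall_sum_pow_smul_eq_zero (ha (k + l)) (k := k) (by omega)
  have h4 : ((k + l : ℕ) : ℤ) - k = (l : ℤ) := by simp
  simp only [a, h4] at h
  exact sub_eq_zero.1 h

end DividedPowers

/-! ### Equivalence of the star products -/

section StarProduct

variable {V : Type*} [AddCommGroup V] [Module ℂ V]

variable (V) in
/-- The span of the tensor products of divided powers. -/
def divPowSpan : Submodule ℂ (Tens V ⊗[ℂ] Tens V) :=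
  Submodule.span ℂ (Set.range fun p : (ℤ × V) × (ℤ × V) =>
    divPow p.1.1 p.1.2 ⊗ₜ[ℂ] divPow p.2.1 p.2.2)

theorem divPow_tmul_mem (k l : ℤ) (v w : V) : divPow k v ⊗ₜ[ℂ] divPow l w ∈ divPowSpan V :=
  Submodule.subset_span ⟨((k, v), (l, w)), rfl⟩

theorem tmul_mem_divPowSpan {X Y : Tens V} (hX : X ∈ SymTens V) (hY : Y ∈ SymTens V) :
    X ⊗ₜ[ℂ] Y ∈ divPowSpan V := by
  have h := Submodule.apply_mem_map₂ (TensorProduct.mk ℂ (Tens V) (Tens V))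
    (symTens_le_span_divPow hX) (symTens_le_span_divPow hY)
  rw [Submodule.map₂_span_span] at h
  refine Submodule.span_mono ?_ h
  rintro _ ⟨_, ⟨p, rfl⟩, _, ⟨q, rfl⟩, rfl⟩
  exact ⟨(p, q), rfl⟩

theorem map_mem_divPowSpan {T : Tens V ⊗[ℂ] Tens V →ₗ[ℂ] Tens V ⊗[ℂ] Tens V}
    (hT : ∀ k l v w, T (divPow k v ⊗ₜ divPow l w) ∈ divPowSpan V) :
    ∀ Z ∈ divPowSpan V, T Z ∈ divPowSpan V := by
  have h : divPowSpan V ≤ (divPowSpan V).comap T := by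
    refine Submodule.span_le.2 ?_
    rintro _ ⟨p, rfl⟩
    exact hT _ _ _ _
  exact fun Z hZ => h hZ

theorem eq_of_eq_on_divPow {M : Type*} [AddCommMonoid M] [Module ℂ M]
    {S T : Tens V ⊗[ℂ] Tens V →ₗ[ℂ] M}
    (h : ∀ k l v w, S (divPow k v ⊗ₜ divPow l w) = T (divPow k v ⊗ₜ divPow l w)) :
    ∀ Z ∈ divPowSpan V, S Z = T Z := by
  refine fun Z hZ => LinearMap.eqOn_span (R := ℂ) ?_ hZ
  rintro _ ⟨p, rfl⟩
  exact h _ _ _ _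

theorem commute_restrict {S T : Tens V ⊗[ℂ] Tens V →ₗ[ℂ] Tens V ⊗[ℂ] Tens V}
    (hS : ∀ Z ∈ divPowSpan V, S Z ∈ divPowSpan V) (hT : ∀ Z ∈ divPowSpan V, T Z ∈ divPowSpan V)
    (h : ∀ k l v w, S (T (divPow k v ⊗ₜ divPow l w)) = T (S (divPow k v ⊗ₜ divPow l w))) :
    Commute (LinearMap.restrict S hS) (LinearMap.restrict T hT) := by
  refine LinearMap.ext fun Z => Subtype.ext ?_
  exact eq_of_eq_on_divPow (S := S.comp T) (T := T.comp S) h Z.1 Z.2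

theorem locallyNilpotent_rTensor {E F : Type*} [AddCommMonoid E] [Module ℂ E] [AddCommMonoid F]
    [Module ℂ F] {D : E →ₗ[ℂ] E} (hD : LocallyNilpotent D) :
    LocallyNilpotent (LinearMap.rTensor F D) := by
  intro Z
  induction Z using TensorProduct.induction_on with
  | zero => exact ⟨0, by simp⟩
  | add X Y hX hY => exact exists_pow_add hX hY
  | tmul X Y =>
    obtain ⟨N, hN⟩ := hD X
    refine ⟨N, ?_⟩
    have h := pow_apply_of_intertwine (D := D) (D' := LinearMap.rTensor F D)
      (μ := (TensorProduct.mk ℂ E F).flip Y) (fun X => rfl) N X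
    rw [hN, map_zero] at h
    exact h.symm

theorem locallyNilpotent_lTensor {E F : Type*} [AddCommMonoid E] [Module ℂ E] [AddCommMonoid F]
    [Module ℂ F] {D : E →ₗ[ℂ] E} (hD : LocallyNilpotent D) :
    LocallyNilpotent (LinearMap.lTensor F D) := by
  intro Z
  induction Z using TensorProduct.induction_on with
  | zero => exact ⟨0, by simp⟩
  | add X Y hX hY => exact exists_pow_add hX hY
  | tmul X Y =>
    obtain ⟨N, hN⟩ := hD Y
    refine ⟨N, ?_⟩
    have h := pow_apply_of_intertwine (D := D) (D' := LinearMap.lTensor F D)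
      (μ := TensorProduct.mk ℂ F E X) (fun X => rfl) N Y
    rw [hN, map_zero] at h
    exact h.symm

theorem rTensor_laplace_divPow (b : LinearMap.BilinForm ℂ V) (k l : ℤ) (v w : V) :
    LinearMap.rTensor (Tens V) (laplace b) (divPow k v ⊗ₜ divPow l w) =
      (b v v / 2) • (divPow (k - 2) v ⊗ₜ[ℂ] divPow l w) := by
  rw [LinearMap.rTensor_tmul, laplace_divPow, TensorProduct.smul_tmul']

theorem lTensor_laplace_divPow (b : LinearMap.BilinForm ℂ V) (k l : ℤ) (v w : V) :
    LinearMap.lTensor (Tens V) (laplace b) (divPow k v ⊗ₜ divPow l w) =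
      (b w w / 2) • (divPow k v ⊗ₜ[ℂ] divPow (l - 2) w) := by
  rw [LinearMap.lTensor_tmul, laplace_divPow, TensorProduct.tmul_smul]

theorem rTensor_laplace_mem (b : LinearMap.BilinForm ℂ V) :
    ∀ Z ∈ divPowSpan V, LinearMap.rTensor (Tens V) (laplace b) Z ∈ divPowSpan V :=
  map_mem_divPowSpan fun k l v w => by
    rw [rTensor_laplace_divPow]
    exact Submodule.smul_mem _ _ (divPow_tmul_mem _ _ _ _)

theorem lTensor_laplace_mem (b : LinearMap.BilinForm ℂ V) :
    ∀ Z ∈ divPowSpan V, LinearMap.lTensor (Tens V) (laplace b) Z ∈ divPowSpan V :=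
  map_mem_divPowSpan fun k l v w => by
    rw [lTensor_laplace_divPow]
    exact Submodule.smul_mem _ _ (divPow_tmul_mem _ _ _ _)

theorem poisson_mem (Λ : LinearMap.BilinForm ℂ V) :
    ∀ Z ∈ divPowSpan V, poisson Λ Z ∈ divPowSpan V :=
  map_mem_divPowSpan fun k l v w => by
    rw [poisson_divPow]
    exact Submodule.smul_mem _ _ (divPow_tmul_mem _ _ _ _)

theorem LocallyNilpotent.restrict {E : Type*} [AddCommMonoid E] [Module ℂ E] {D : E →ₗ[ℂ] E}
    (hD : LocallyNilpotent D) {S : Submodule ℂ E} (hS : ∀ X ∈ S, D X ∈ S) :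
    LocallyNilpotent (D.restrict hS) :=
  LocallyNilpotent.of_intertwine hD S.injective_subtype fun _ => rfl

theorem LocallyNilpotent.coe_exp_restrict {E : Type*} [AddCommMonoid E] [Module ℂ E]
    {D : E →ₗ[ℂ] E} (hD : LocallyNilpotent D) {S : Submodule ℂ E} (hS : ∀ X ∈ S, D X ∈ S) (X : S) :
    ((hD.restrict hS).exp X : E) = hD.exp X :=
  (hD.restrict hS).apply_exp hD (μ := S.subtype) (fun _ => rfl) X

/-- The operators are restricted to `divPowSpan`, since on general tensors they need not commute: 1
⊗ Δ_b and P_Λ both consume leading factors of the second tensor, in an order that matters. -/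
theorem expLaplace_mulVee (b Λ : LinearMap.BilinForm ℂ V) (hb : ∀ v w, b v w = b w v)
    {X Y : Tens V} (hX : X ∈ SymTens V) (hY : Y ∈ SymTens V) :
    expLaplace b (mulVee ((poisson_locallyNilpotent Λ).exp (X ⊗ₜ Y)) : SymTens V) =
      (mulVee ((poisson_locallyNilpotent (Λ + b)).exp
        (expLaplace b X ⊗ₜ expLaplace b Y)) : SymTens V) := by
  let Z : divPowSpan V := ⟨X ⊗ₜ Y, tmul_mem_divPowSpan hX hY⟩
  let μ : divPowSpan V →ₗ[ℂ] Tens V :=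
    (SymTens V).subtype ∘ₗ mulVee ∘ₗ (divPowSpan V).subtype
  have hA' := locallyNilpotent_rTensor (F := Tens V) (laplace_locallyNilpotent b)
  have hB' := locallyNilpotent_lTensor (F := Tens V) (laplace_locallyNilpotent b)
  have hA : LocallyNilpotent
      ((LinearMap.rTensor (Tens V) (laplace b)).restrict (rTensor_laplace_mem b)) :=
    hA'.restrict _
  have hB : LocallyNilpotent
      ((LinearMap.lTensor (Tens V) (laplace b)).restrict (lTensor_laplace_mem b)) :=
    hB'.restrict _
  have hP : ∀ Λ : LinearMap.BilinForm ℂ V,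
      LocallyNilpotent ((poisson Λ).restrict (poisson_mem Λ)) := fun Λ =>
    (poisson_locallyNilpotent Λ).restrict _
  have hAB : Commute ((LinearMap.rTensor (Tens V) (laplace b)).restrict (rTensor_laplace_mem b))
      ((LinearMap.lTensor (Tens V) (laplace b)).restrict (lTensor_laplace_mem b)) :=
    commute_restrict _ _ fun k l v w => by
      simp only [rTensor_laplace_divPow, lTensor_laplace_divPow, map_smul, smul_smul, mul_comm]
  have hAP : ∀ Λ : LinearMap.BilinForm ℂ V,
      Commute ((LinearMap.rTensor (Tens V) (laplace b)).restrict (rTensor_laplace_mem b))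
        ((poisson Λ).restrict (poisson_mem Λ)) := fun Λ =>
    commute_restrict _ _ fun k l v w => by
      simp only [rTensor_laplace_divPow, poisson_divPow, map_smul, smul_smul, mul_comm,
        sub_right_comm]
  have hBP : ∀ Λ : LinearMap.BilinForm ℂ V,
      Commute ((LinearMap.lTensor (Tens V) (laplace b)).restrict (lTensor_laplace_mem b))
        ((poisson Λ).restrict (poisson_mem Λ)) := fun Λ =>
    commute_restrict _ _ fun k l v w => by
      simp only [lTensor_laplace_divPow, poisson_divPow, map_smul, smul_smul, mul_comm,
        sub_right_comm]
  have hPP : Commute ((poisson b).restrict (poisson_mem b))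
      ((poisson Λ).restrict (poisson_mem Λ)) :=
    commute_restrict _ _ fun k l v w => by
      simp only [poisson_divPow, map_smul, smul_smul, mul_comm]
  set A := (LinearMap.rTensor (Tens V) (laplace b)).restrict (rTensor_laplace_mem b)
  set B := (LinearMap.lTensor (Tens V) (laplace b)).restrict (lTensor_laplace_mem b)
  have hPadd : (poisson (Λ + b)).restrict (poisson_mem (Λ + b)) =
      (poisson Λ).restrict (poisson_mem Λ) + (poisson b).restrict (poisson_mem b) := by
    refine LinearMap.ext fun Z => Subtype.ext ?_
    refine eq_of_eq_on_divPow (S := poisson (Λ + b)) (T := poisson Λ + poisson b)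
      (fun k l v w => ?_) Z.1 Z.2
    simp only [LinearMap.add_apply, poisson_divPow, add_smul]
  have hABln : LocallyNilpotent (A + B) := hA.add hB hAB
  have hC : LocallyNilpotent ((A + B) + (poisson b).restrict (poisson_mem b)) :=
    hABln.add (hP b) ((hAP b).add_left (hBP b))
  -- The Leibniz rule in operator form; it lets the exponential of Δ_b pass through the product.
  have hμ : ∀ Z, μ (((A + B) + (poisson b).restrict (poisson_mem b)) Z) = laplace b (μ Z) := by
    intro Z
    let μ' : Tens V ⊗[ℂ] Tens V →ₗ[ℂ] Tens V := (SymTens V).subtype ∘ₗ mulVee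
    refine eq_of_eq_on_divPow (S := μ' ∘ₗ (LinearMap.rTensor (Tens V) (laplace b) +
      LinearMap.lTensor (Tens V) (laplace b) + poisson b)) (T := laplace b ∘ₗ μ')
      (fun k l v w => ?_) Z.1 Z.2
    change μ' _ = laplace b (veePow k l v w)
    simp only [LinearMap.add_apply, rTensor_laplace_divPow, lTensor_laplace_divPow,
      poisson_divPow, map_add, map_smul]
    exact (laplace_veePow b hb k l v w).symm
  have h1 : ((hP Λ).exp Z : Tens V ⊗[ℂ] Tens V) = (poisson_locallyNilpotent Λ).exp (X ⊗ₜ Y) :=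
    (poisson_locallyNilpotent Λ).coe_exp_restrict (poisson_mem Λ) Z
  have h2 : (hA.exp (hB.exp Z) : Tens V ⊗[ℂ] Tens V) = expLaplace b X ⊗ₜ expLaplace b Y := by
    have h3 : (hB.exp Z : Tens V ⊗[ℂ] Tens V) = X ⊗ₜ expLaplace b Y := by
      refine (hB'.coe_exp_restrict (lTensor_laplace_mem b) Z).trans ?_
      exact ((laplace_locallyNilpotent b).apply_exp hB' (μ := TensorProduct.mk ℂ _ _ X)
        (fun _ => rfl) Y).symm
    refine (hA'.coe_exp_restrict (rTensor_laplace_mem b) _).trans ?_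
    rw [h3]
    exact ((laplace_locallyNilpotent b).apply_exp hA'
      (μ := (TensorProduct.mk ℂ _ _).flip (expLaplace b Y)) (fun _ => rfl) X).symm
  have hcomm : Commute (A + B) ((poisson Λ).restrict (poisson_mem Λ)) :=
    (hAP Λ).add_left (hBP Λ)
  have hsum : LocallyNilpotent (((A + B) + (poisson b).restrict (poisson_mem b)) +
      (poisson Λ).restrict (poisson_mem Λ)) :=
    hC.add (hP Λ) (hcomm.add_left hPP)
  -- Both sides are the exponential of Δ_b ⊗ 1 + 1 ⊗ Δ_b + P_b + P_Λ, with the commuting summands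
  -- grouped in two ways.
  have h3 : hC.exp ((hP Λ).exp Z) = (hP (Λ + b)).exp (hA.exp (hB.exp Z)) := by
    rw [← hC.exp_add (hP Λ) hsum (hcomm.add_left hPP) rfl, ← hA.exp_add hB hABln hAB rfl]
    refine (hP (Λ + b)).exp_add hABln hsum ((hAP _).add_left (hBP _)).symm ?_ Z
    rw [hPadd]
    abel
  calc _ = expLaplace b (μ ((hP Λ).exp Z)) := by rw [← h1]; rfl
    _ = μ (hC.exp ((hP Λ).exp Z)) := (hC.apply_exp (laplace_locallyNilpotent b) hμ _).symm
    _ = μ ((hP (Λ + b)).exp (hA.exp (hB.exp Z))) := by rw [h3]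
    _ = _ := by
      rw [← h2, ← (poisson_locallyNilpotent (Λ + b)).coe_exp_restrict (poisson_mem (Λ + b))]
      rfl

theorem expLaplaceSym_starProd (b Λ : LinearMap.BilinForm ℂ V) (hb : ∀ v w, b v w = b w v)
    (X Y : SymTens V) :
    expLaplaceSym b (starProd Λ X Y) =
      starProd (Λ + b) (expLaplaceSym b X) (expLaplaceSym b Y) :=
  Subtype.ext (expLaplace_mulVee b Λ hb X.2 Y.2)

theorem contractFirst_neg (b : LinearMap.BilinForm ℂ V) (k : ℕ) (x : ⨂[ℂ]^(k + 2) V) :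
    contractFirst (-b) k x = -contractFirst b k x := by
  have h : contractFirst (-b) k = -contractFirst b k := by
    ext x
    simp [contractFirst_tprod]
  exact LinearMap.congr_fun h x

theorem laplace_neg (b : LinearMap.BilinForm ℂ V) : laplace (-b) = -laplace b := by
  refine LinearMap.ext fun X => ?_
  ext k : 1
  change laplace (-b) X k = -(laplace b X k)
  rw [laplace_apply, laplace_apply, contractFirst_neg, smul_neg]

theorem expLaplaceSym_neg_apply (b : LinearMap.BilinForm ℂ V) (X : SymTens V) :
    expLaplaceSym b (expLaplaceSym (-b) X) = X :=
  Subtype.ext ((laplace_locallyNilpotent b).exp_exp_neg (laplace_locallyNilpotent (-b))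
    (laplace_neg b) X)

end StarProduct

/-! ### Continuity of b and the homeomorphism -/

section Topology

variable {V : Type*} [AddCommGroup V] [Module ℂ V] [TopologicalSpace V]

/-- Domination gives |b(v, w)| ≤ ‖v‖_α ‖w‖_α, and `hV` makes the seminorm continuous; the increment
of `b` is split one argument at a time. -/
theorem IsHilbertSchmidt.continuous_apply (hV : WithSeminorms (hilbertSeminorms V))
    {b : LinearMap.BilinForm ℂ V} (hb : IsHilbertSchmidt b) :
    Continuous fun p : V × V => b p.1 p.2 := by
  obtain ⟨α, hα⟩ := hb.exists_dominated
  have hp : Continuous (hilbertSeminorms V α) := hV.continuous_seminorm α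
  have hVg := hV.topologicalAddGroup
  have hle : ∀ v w, ‖b v w‖ ≤ hilbertSeminorms V α v * hilbertSeminorms V α w :=
    hα.norm_apply_le α.isPosHermitian
  refine continuous_iff_continuousAt.2 fun p => ?_
  rw [ContinuousAt, tendsto_iff_norm_sub_tendsto_zero]
  have h1 : Filter.Tendsto (fun q : V × V =>
      hilbertSeminorms V α (q.1 - p.1) * hilbertSeminorms V α q.2 +
        hilbertSeminorms V α p.1 * hilbertSeminorms V α (q.2 - p.2)) (nhds p) (nhds 0) := by
    have h2 : Continuous (fun q : V × V =>
        hilbertSeminorms V α (q.1 - p.1) * hilbertSeminorms V α q.2 +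
          hilbertSeminorms V α p.1 * hilbertSeminorms V α (q.2 - p.2)) := by
      fun_prop
    simpa using h2.tendsto p
  refine squeeze_zero (fun _ => norm_nonneg _) (fun q => ?_) h1
  have h3 : b q.1 q.2 - b p.1 p.2 = b (q.1 - p.1) q.2 + b p.1 (q.2 - p.2) := by
    simp
  rw [h3]
  exact (norm_add_le _ _).trans (add_le_add (hle _ _) (hle _ _))

/-- The operator `e^{Δ_b}` as a linear homeomorphism of the space of symmetric tensors. -/
def IsHilbertSchmidt.expLaplaceEquiv {b : LinearMap.BilinForm ℂ V} (hb : IsHilbertSchmidt b) :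
    SymTens V ≃L[ℂ] SymTens V where
  toLinearEquiv := LinearEquiv.ofLinearMap (expLaplaceSym b) (expLaplaceSym (-b))
    (LinearMap.ext fun X => expLaplaceSym_neg_apply b X)
    (LinearMap.ext fun X => by simpa using expLaplaceSym_neg_apply (-b) X)
  continuous_toFun := continuous_expLaplaceSym hb.continuous_expLaplace
  continuous_invFun := continuous_expLaplaceSym hb.neg.continuous_expLaplace

end Topology

end HilbertTensor

end

theorem theorem3p10 {V : Type*} [AddCommGroup V] [Module ℂ V] [TopologicalSpace V] [T2Space V]
    (hV : WithSeminorms (HilbertTensor.hilbertSeminorms V))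
    (b : LinearMap.BilinForm ℂ V) (hb : ∀ v w, b v w = b w v) :
    (Continuous (HilbertTensor.expLaplace b) ↔ HilbertTensor.IsHilbertSchmidt b) ∧
    (Continuous (HilbertTensor.expLaplaceSym b) ↔ HilbertTensor.IsHilbertSchmidt b) ∧
    (HilbertTensor.IsHilbertSchmidt b →
      (∀ Λ : LinearMap.BilinForm ℂ V, Continuous (fun p : V × V => Λ p.1 p.2) →
        Continuous (fun p : V × V => (Λ + b) p.1 p.2) ∧
        (∀ X Y : HilbertTensor.SymTens V,
          HilbertTensor.expLaplaceSym b (HilbertTensor.starProd Λ X Y) =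
            HilbertTensor.starProd (Λ + b)
              (HilbertTensor.expLaplaceSym b X) (HilbertTensor.expLaplaceSym b Y)) ∧
        ∃ φ : HilbertTensor.SymTens V ≃L[ℂ] HilbertTensor.SymTens V,
          (∀ X, φ X = HilbertTensor.expLaplaceSym b X) ∧
          ∀ X Y, φ (HilbertTensor.starProd Λ X Y) =
            HilbertTensor.starProd (Λ + b) (φ X) (φ Y)) ∧
      ∃ D : HilbertTensor.SymCpl V →L[ℂ] HilbertTensor.SymCpl V,
        (∀ X : HilbertTensor.SymTens V, D X = (HilbertTensor.laplaceSym b X : HilbertTensor.SymTens V)) ∧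
        ∀ X : HilbertTensor.SymCpl V, ∃ F : ℂ → HilbertTensor.SymCpl V,
          (∀ q : Seminorm ℂ (HilbertTensor.SymCpl V), Continuous q →
            ∀ z : ℂ, Summable fun t : ℕ => q ((z ^ t / (t.factorial : ℂ)) • (D ^ t) X)) ∧
          (∀ z : ℂ, HasSum (fun t : ℕ => (z ^ t / (t.factorial : ℂ)) • (D ^ t) X) (F z)) ∧
          TendstoLocallyUniformly
            (fun (N : ℕ) (z : ℂ) =>
              ∑ t ∈ Finset.range N, (z ^ t / (t.factorial : ℂ)) • (D ^ t) X)
            F Filter.atTop ∧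
          Differentiable ℂ F) := by
  have hcont : HilbertTensor.IsHilbertSchmidt b → Continuous (HilbertTensor.expLaplace b) :=
    fun h => h.continuous_expLaplace
  -- Continuity on the tensor algebra restricts to symmetric tensors, so one converse, on symmetric
  -- tensors, serves both equivalences.
  refine ⟨⟨fun h => HilbertTensor.isHilbertSchmidt_of_continuous hb
    (HilbertTensor.continuous_expLaplaceSym h), hcont⟩,
    ⟨HilbertTensor.isHilbertSchmidt_of_continuous hb,
      fun h => HilbertTensor.continuous_expLaplaceSym (hcont h)⟩,
    fun h => ⟨fun Λ hΛ => ⟨hΛ.add (h.continuous_apply hV),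
      HilbertTensor.expLaplaceSym_starProd b Λ hb, h.expLaplaceEquiv, fun _ => rfl,
      HilbertTensor.expLaplaceSym_starProd b Λ hb⟩, h.exists_series⟩⟩
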